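/- Let $A$ be a finite alphabet and let $\sigma$ denote the shift, $\sigma(z)_i=z_{i+1}$, on $A^{\mathbb N}$ and on $A^{\mathbb Z}$. A one-sided subshift is a closed set $\Sigma\subseteq A^{\mathbb N}$ with $\sigma(\Sigma)\subseteq\Sigma$, and it is surjective if $\sigma(\Sigma)=\Sigma$; a two-sided subshift is a closed set $\Sigma\subseteq A^{\mathbb Z}$ with $\sigma(\Sigma)=\Sigma$. A subshift is of finite type if it is the set of all words avoiding some finite set of forbidden finite words, and sofic if the language of its finite factors is regular. For a nonempty $A'\subseteq A$ and $\xi:A'\to A'$, the one-sided deterministic subshift of $\xi$ is $\{(\xi^j(a))_{j\in\mathbb N} : a\in A'\}$, and the two-sided one is $\{z\in A'^{\mathbb Z} : z_{j+1}=\xi(z_j)\text{ for all } j\in\mathbb Z\}$. For a one-dimensional cellular automaton (CA) with global map $F:A^{\mathbb Z}\to A^{\mathbb Z}$, the trace is $\tau_F=\{(F^j(x)_0)_{j\in\mathbb N} : x\in A^{\mathbb Z}\}$, the limit trace is $\bigcap_{j\in\mathbb N}\sigma^j(\tau_F)$, and the bitrace is $\{(x^j_0)_{j\in\mathbb Z}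 : x^j\in A^{\mathbb Z},\ F(x^j)=x^{j+1}\text{ for all } j\in\mathbb Z\}$. Call the CA stable if its trace reaches the limit trace in finite time, that is, if $\sigma^J(\tau_F)=\bigcap_{j\in\mathbb N}\sigma^j(\tau_F)$ for some $J\in\mathbb N$. (1) Let $\Sigma\subseteq A^{\mathbb N}$ be a surjective one-sided subshift that contains the one-sided deterministic subshift of some $\xi:A'\to A'$ with $\emptyset\ne A'\subseteq A$, and that is either of finite type or uncountable and sofic. Then $\Sigma$ is the limit trace of some stable CA on the alphabet $A$. (2) Let $\Sigma\subseteq A^{\mathbb Z}$ be a two-sided subshift that contains the two-sided deterministic subshift of some $\xi:A'\to A'$ with $\emptyset\ne A'\subseteq A$, and that is either of finite type or uncountable and sofic. Then $\Sigma$ is the bitrace of some stable CA on the alphabet $A$. -/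

import Mathlib

namespace TraceCA

section Words

variable {M A : Type*} [AddMonoidWithOne M]

/-- The shift on infinite words (`M = ℕ`) and on biinfinite words (`M = ℤ`). -/
def shift (z : M → A) : M → A := fun i => z (i + 1)

/-- The finite word `w` is a factor of the (bi)infinite word `z`. -/
def IsFactor (w : List A) (z : M → A) : Prop :=
  ∃ i : M, ∀ k : Fin w.length, z (i + ((k : ℕ) : M)) = w.get k

/-- The language of a set of (bi)infinite words: all factors of its elements. -/
def language (S : Set (M → A)) : Language A := {w | ∃ z ∈ S, IsFactor w z}

/-- `S` is the set of words avoiding some finite set of forbidden finite words. -/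
def IsFiniteType (S : Set (M → A)) : Prop :=
  ∃ W : Set (List A), W.Finite ∧ S = {z | ∀ w ∈ W, ¬ IsFactor w z}

/-- `S` has a regular language. -/
def IsSofic (S : Set (M → A)) : Prop := (language S).IsRegular

end Words

section Subshifts

variable {A : Type*}

/-- Onesided subshift: a closed set of infinite words with `σ(S) ⊆ S`. -/
def IsOneSidedSubshift [TopologicalSpace A] (S : Set (ℕ → A)) : Prop :=
  IsClosed S ∧ shift '' S ⊆ S

/-- Twosided subshift: a closed set of biinfinite words with `σ(S) = S`. -/
def IsTwoSidedSubshift [TopologicalSpace A] (S : Set (ℤ → A)) : Prop :=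
  IsClosed S ∧ shift '' S = S

/-- A onesided subshift is surjective when the shift maps it onto itself. -/
def IsSurjectiveSubshift (S : Set (ℕ → A)) : Prop := shift '' S = S

/-- The onesided deterministic subshift of a self-map `ξ` of a set `A'` of letters:
the orbits `(ξ^j(a))_{j ∈ ℕ}` of the letters `a ∈ A'`. -/
def detSubshift (A' : Set A) (ξ : A → A) : Set (ℕ → A) :=
  {z | ∃ a ∈ A', ∀ j, z j = ξ^[j] a}

/-- The twosided deterministic subshift of a self-map `ξ` of a set `A'` of letters:
the biinfinite orbits of `ξ` in `A'`. -/
def biDetSubshift (A' : Set A) (ξ : A → A) : Set (ℤ → A) :=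
  {z | ∀ j, z j ∈ A' ∧ z (j + 1) = ξ (z j)}

/-- `S` contains the deterministic subshift of some map `ξ : A' → A'`, where `A'` is a nonempty
set of letters (not necessarily the whole alphabet). -/
def ContainsDeterministic (S : Set (ℕ → A)) : Prop :=
  ∃ (A' : Set A) (ξ : A → A), A'.Nonempty ∧ Set.MapsTo ξ A' A' ∧ detSubshift A' ξ ⊆ S

/-- Twosided version of `ContainsDeterministic`. -/
def ContainsBiDeterministic (S : Set (ℤ → A)) : Prop :=
  ∃ (A' : Set A) (ξ : A → A), A'.Nonempty ∧ Set.MapsTo ξ A' A' ∧ biDetSubshift A' ξ ⊆ S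

end Subshifts

/-- A one-dimensional cellular automaton on the alphabet `A`, given by its anchor, its positive
diameter and its local rule. -/
structure CellularAutomaton (A : Type*) where
  anchor : ℤ
  diameter : ℕ
  diameter_pos : 0 < diameter
  rule : (Fin diameter → A) → A

namespace CellularAutomaton

variable {A : Type*} (F : CellularAutomaton A)

/-- The global function: cell `i` reads the cells `i - m, …, i - m + d - 1`. -/
def globalMap (x : ℤ → A) : ℤ → A :=
  fun i => F.rule fun k => x (i - F.anchor + ((k : ℕ) : ℤ))

/-- The trace: the sequences of states taken by cell `0` along all orbits. -/
def trace : Set (ℕ → A) := Set.range fun (x : ℤ → A) (j : ℕ) => (F.globalMap^[j] x) 0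

/-- The limit trace `⋂ j, σ^j(τ_F)`. -/
def limitTrace : Set (ℕ → A) := ⋂ j : ℕ, shift^[j] '' F.trace

/-- The bitrace: the sequences of states taken by cell `0` along all biinfinite orbits. -/
def bitrace : Set (ℤ → A) :=
  {z | ∃ x : ℤ → ℤ → A, (∀ j, F.globalMap (x j) = x (j + 1)) ∧ ∀ j, z j = x j 0}

/-- The automaton is stable (with respect to its trace): the decreasing sequence of the `σ^j(τ_F)`
reaches the limit trace after finitely many steps. -/
def IsStable : Prop := ∃ J : ℕ, shift^[J] '' F.trace = F.limitTrace

end CellularAutomaton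

end TraceCA

namespace TraceCA

/-! ### Cellular automata, iterated shifts and compactness -/

section General

variable {A : Type*}

/-! Starting from an arbitrary configuration, the automaton must recognise groups of `m` cells
(frames) that simulate S, while every other cell, delimiters included, must also show a column of S.
`exists_of_frames` isolates what suffices: frames are disjoint, persist and are not created after
the first step; the letter map `g` of the other cells and the frame update `U` produce only columns
of S; and a chain of frames at distance `D` realises each element of S. Then two shifts of the trace
give S exactly.

Inside a frame (`exists_update`) a register holds a factor of an element of a subshift of finite
type over several tracks. It pushes the letter offered by the next frame if that letter is an
admissible continuation, and some admissible letter otherwise. Hence columns are always legal, and a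
chain loaded with consecutive factors of η replays η. For S of finite type one track suffices. A
sofic S is read off the paths of a finite graph, whose vertices are not letters: uncountability
gives two distinct words of equal length that concatenate freely in S (`exists_freePair`), and paths
are coded by tracks made of these words.

Delimiters come from a periodic letter b of ξ. If ξ b ≠ b, patterns of letters c and ξ c on the
cycle keep their shape under ξ (`exists_of_cycle`). If b is fixed, it serves as background, and
frames carry a marker written with a nonconstant periodic element of S (`exists_of_fixed`); if S has
no element other than the constant b, a constant automaton does.

The two-sided case applies this to the right rays of S; closedness and compactness then identify the
bitrace (`bitrace_eq`). -/

/-- A map on configurations that is shift-equivariant and depends on a finite window is the global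
map of a cellular automaton. -/
theorem exists_cellularAutomaton (Φ : (ℤ → A) → ℤ → A) (r : ℕ)
    (hΦ : ∀ x y i j, (∀ l : ℤ, |l| ≤ r → x (i + l) = y (j + l)) → Φ x i = Φ y j) :
    ∃ F : CellularAutomaton A, F.globalMap = Φ := by
  -- Positions outside the window are clamped to its edge; by locality their values are irrelevant.
  refine ⟨⟨r, 2 * r + 1, by omega, fun u => Φ (fun l =>
    u ⟨min (l + r).toNat (2 * r), by omega⟩) 0⟩, ?_⟩
  funext x i
  simp only [CellularAutomaton.globalMap]
  apply hΦ
  intro l hl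
  rw [abs_le] at hl
  congr 1
  have : min (0 + l + (r : ℤ)).toNat (2 * r) = (0 + l + (r : ℤ)).toNat := by omega
  rw [this]
  omega

theorem shift_iterate_apply (z : ℕ → A) (j i : ℕ) : shift^[j] z i = z (i + j) := by
  induction j generalizing z with
  | zero => rfl
  | succ j ih => rw [Function.iterate_succ_apply, ih]; rfl

theorem shift_iterate_mem {S : Set (ℕ → A)} (hS : shift '' S = S) {z : ℕ → A} (hz : z ∈ S)
    (j : ℕ) : shift^[j] z ∈ S := by
  induction j generalizing z with
  | zero => exact hz
  | succ j ih => rw [Function.iterate_succ_apply]; exact ih (hS ▸ Set.mem_image_of_mem _ hz)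

theorem tail_mem {S : Set (ℕ → A)} (hS : shift '' S = S) {z : ℕ → A} (hz : z ∈ S)
    (j : ℕ) : (fun i => z (i + j)) ∈ S := by
  have := shift_iterate_mem hS hz j
  convert this using 1
  funext i
  rw [shift_iterate_apply]

theorem image_shift_iterate {S : Set (ℕ → A)} (hS : shift '' S = S) (j : ℕ) :
    shift^[j] '' S = S := by
  induction j with
  | zero => simp
  | succ j ih => rw [Function.iterate_succ, Set.image_comp, hS, ih]

theorem exists_tail_eq {S : Set (ℕ → A)} (hS : shift '' S = S) {z : ℕ → A} (hz : z ∈ S)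
    (j : ℕ) : ∃ y ∈ S, ∀ i, y (i + j) = z i := by
  rw [← image_shift_iterate hS j] at hz
  obtain ⟨y, hy, rfl⟩ := hz
  exact ⟨y, hy, fun i => (shift_iterate_apply _ _ _).symm⟩

theorem image_shift_trace_subset (F : CellularAutomaton A) : shift '' F.trace ⊆ F.trace := by
  rintro _ ⟨_, ⟨x, rfl⟩, rfl⟩
  exact ⟨F.globalMap x, rfl⟩

/-- If the trace reaches a surjective subshift in finite time, then this is the limit trace. -/
theorem limitTrace_eq (F : CellularAutomaton A) {S : Set (ℕ → A)} (hS : shift '' S = S) {J : ℕ}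
    (h : shift^[J] '' F.trace = S) : F.IsStable ∧ F.limitTrace = S := by
  have key : F.limitTrace = S := by
    apply Set.Subset.antisymm
    · rw [← h]
      exact Set.iInter_subset _ J
    · refine Set.subset_iInter fun j => ?_
      have hsub : ∀ n, shift^[n] '' F.trace ⊆ F.trace := by
        intro n
        induction n with
        | zero => simp
        | succ n ih =>
          rw [Function.iterate_succ, Set.image_comp]
          exact (Set.image_mono (image_shift_trace_subset F)).trans ih
      calc S = shift^[j] '' S := (image_shift_iterate hS j).symm
        _ = shift^[j] '' (shift^[J] '' F.trace) := by rw [h]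
        _ ⊆ shift^[j] '' F.trace := Set.image_mono (hsub J)
  exact ⟨⟨J, h.trans key.symm⟩, key⟩

/-- A sequence all of whose prefixes are prefixes of elements of a closed set belongs to it. -/
theorem mem_of_prefixes [TopologicalSpace A] {S : Set (ℕ → A)} (hS : IsClosed S) {z : ℕ → A}
    (h : ∀ n, ∃ s ∈ S, ∀ i < n, s i = z i) : z ∈ S := by
  choose s hs hsz using h
  refine hS.mem_of_tendsto (f := s) (b := Filter.atTop) ?_ (Filter.Eventually.of_forall hs)
  rw [tendsto_pi_nhds]
  intro i
  refine tendsto_const_nhds.congr' ?_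
  filter_upwards [Filter.eventually_gt_atTop i] with n hn
  exact (hsz n i hn).symm

/-- A biinfinite sequence all of whose central factors occur in elements of a closed set belongs
to it. -/
theorem mem_of_central [TopologicalSpace A] {S : Set (ℤ → A)} (hS : IsClosed S) {z : ℤ → A}
    (h : ∀ n : ℕ, ∃ s ∈ S, ∀ i : ℤ, |i| < n → s i = z i) : z ∈ S := by
  choose s hs hsz using h
  refine hS.mem_of_tendsto (f := s) (b := Filter.atTop) ?_ (Filter.Eventually.of_forall hs)
  rw [tendsto_pi_nhds]
  intro i
  refine tendsto_const_nhds.congr' ?_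
  filter_upwards [Filter.eventually_gt_atTop i.natAbs] with n hn
  exact (hsz n i (by rw [Int.abs_eq_natAbs]; exact_mod_cast hn)).symm

theorem continuous_globalMap [TopologicalSpace A] [DiscreteTopology A] [Finite A]
    (F : CellularAutomaton A) : Continuous F.globalMap := by
  refine continuous_pi fun i => ?_
  exact (continuous_of_discreteTopology (f := F.rule)).comp
    (continuous_pi fun k => continuous_apply _)

/-- Every biinfinite sequence whose right rays are in the trace belongs to the bitrace. -/
theorem mem_bitrace_of_rays [TopologicalSpace A] [DiscreteTopology A] [Finite A]
    (F : CellularAutomaton A) {z : ℤ → A}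
    (h : ∀ n : ℕ, (fun j : ℕ => z (-(n : ℤ) + j)) ∈ F.trace) : z ∈ F.bitrace := by
  -- Space-time diagrams that are orbits with central column `z` from time `-n` on: nested nonempty
  -- closed subsets of a compact space.
  let K : ℕ → Set (ℤ → ℤ → A) := fun n =>
    {x | ∀ j : ℤ, -(n : ℤ) ≤ j → F.globalMap (x j) = x (j + 1) ∧ z j = x j 0}
  have hcl : ∀ n, IsClosed (K n) := by
    intro n
    simp only [K, Set.ofPred_forall, Set.ofPred_and]
    refine isClosed_iInter fun j => isClosed_iInter fun _ => IsClosed.inter ?_ ?_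
    · exact isClosed_eq ((continuous_globalMap F).comp (continuous_apply j)) (continuous_apply _)
    · exact isClosed_eq continuous_const ((continuous_apply 0).comp (continuous_apply j))
  have hne : (⋂ n, K n).Nonempty := by
    apply IsCompact.nonempty_iInter_of_sequence_nonempty_isCompact_isClosed
    · intro n x hx j hj
      exact hx j (by push_cast; omega)
    · intro n
      obtain ⟨x, hx⟩ := h n
      refine ⟨fun j => F.globalMap^[(j + n).toNat] x, fun j hj => ⟨?_, ?_⟩⟩
      · rw [← Function.iterate_succ_apply' F.globalMap]
        congr 2
        omega
      · have := congrFun hx (j + n).toNat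
        simp only at this ⊢
        rw [this]
        congr 1
        omega
    · exact (hcl 0).isCompact
    · exact hcl
  obtain ⟨x, hx⟩ := hne
  rw [Set.mem_iInter] at hx
  have hx' : ∀ j : ℤ, F.globalMap (x j) = x (j + 1) ∧ z j = x j 0 := fun j =>
    hx j.natAbs j (by omega)
  exact ⟨x, fun j => (hx' j).1, fun j => (hx' j).2⟩

end General

end TraceCA

namespace TraceCA

/-! ### Frames and the automaton that updates them -/

section Frames

variable {A : Type*} {m : ℕ}

/-- The `m` letters of `x` starting at position `i`. -/
def cells (m : ℕ) (x : ℤ → A) (i : ℤ) : Fin m → A := fun k => x (i + (k : ℕ))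

open Classical in
/-- The map that updates the cells `i, …, i + m - 1` by `U` whenever `act x i` holds, with the
content of the frame at `i + D` as additional input if `act x (i + D)` holds, and that applies `g`
to all other cells. -/
noncomputable def frameMap (U : (Fin m → A) → Option (Fin m → A) → Fin m → A)
    (act : (ℤ → A) → ℤ → Prop) (g : A → A) (D : ℤ) (x : ℤ → A) (c : ℤ) : A :=
  if h : ∃ k : Fin m, act x (c - (k : ℕ)) then
    U (cells m x (c - (h.choose : ℕ)))
      (if act x (c - (h.choose : ℕ) + D) then some (cells m x (c - (h.choose : ℕ) + D)) else none)
      h.choose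
  else g (x c)

variable {U : (Fin m → A) → Option (Fin m → A) → Fin m → A} {act : (ℤ → A) → ℤ → Prop}
  {g : A → A} {D : ℤ}

theorem frameMap_of_not (x : ℤ → A) (c : ℤ) (h : ¬ ∃ k : Fin m, act x (c - (k : ℕ))) :
    frameMap U act g D x c = g (x c) := by
  rw [frameMap, dif_neg h]

open Classical in
theorem frameMap_of_act (hsep : ∀ x i j, act x i → act x j → i < j → i + m ≤ j)
    (x : ℤ → A) (i : ℤ) (hi : act x i) (k : Fin m) :
    frameMap U act g D x (i + (k : ℕ)) =
      U (cells m x i) (if act x (i + D) then some (cells m x (i + D)) else none) k := by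
  have h : ∃ k' : Fin m, act x (i + (k : ℕ) - (k' : ℕ)) := ⟨k, by simpa using hi⟩
  -- Separation makes the frame containing a given cell unique, so the choice in `frameMap` is
  -- forced.
  have hk : h.choose = k := by
    have h1 := h.choose_spec
    have hlt := h.choose.isLt
    have hlt' := k.isLt
    rcases lt_trichotomy ((h.choose : ℕ) : ℤ) (k : ℕ) with hh | hh | hh
    · have := hsep x _ _ hi h1 (by omega)
      omega
    · exact Fin.ext (by exact_mod_cast hh)
    · have := hsep x _ _ h1 hi (by omega)
      omega
  rw [frameMap, dif_pos h, hk]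
  simp

open Classical in
theorem cells_frameMap (hsep : ∀ x i j, act x i → act x j → i < j → i + m ≤ j)
    (x : ℤ → A) (i : ℤ) (hi : act x i) :
    cells m (frameMap U act g D x) i =
      U (cells m x i) (if act x (i + D) then some (cells m x (i + D)) else none) := by
  funext k
  exact frameMap_of_act hsep x i hi k

theorem cells_congr {x y : ℤ → A} {i j : ℤ} (h : ∀ k : ℕ, k < m → x (i + k) = y (j + k)) :
    cells m x i = cells m y j := funext fun k => h k k.isLt

theorem frameMap_local (hsep : ∀ x i j, act x i → act x j → i < j → i + m ≤ j) (hD : 0 ≤ D)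
    (r : ℕ) (hact : ∀ x y i j, (∀ l : ℤ, |l| ≤ r → x (i + l) = y (j + l)) → act x i → act y j) :
    ∀ x y i j, (∀ l : ℤ, |l| ≤ (r + 2 * m + D.toNat : ℕ) → x (i + l) = y (j + l)) →
      frameMap U act g D x i = frameMap U act g D y j := by
  classical
  intro x y i j hxy
  have key : ∀ e : ℤ, |e| ≤ m + D → (act x (i + e) ↔ act y (j + e)) := by
    intro e he
    rw [abs_le] at he
    constructor
    · refine hact _ _ _ _ fun l hl => ?_
      rw [add_assoc, add_assoc]
      refine hxy _ ?_
      rw [abs_le] at hl ⊢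
      push_cast
      constructor <;> omega
    · refine hact _ _ _ _ fun l hl => ?_
      rw [add_assoc, add_assoc]
      refine (hxy _ ?_).symm
      rw [abs_le] at hl ⊢
      push_cast
      constructor <;> omega
  have hcells : ∀ e : ℤ, |e| ≤ m + D → cells m x (i + e) = cells m y (j + e) := by
    intro e he
    rw [abs_le] at he
    refine cells_congr fun k hk => ?_
    rw [add_assoc, add_assoc]
    refine hxy _ ?_
    rw [abs_le]
    push_cast
    constructor <;> omega
  by_cases h : ∃ k : Fin m, act x (i - (k : ℕ))
  · obtain ⟨k, hk⟩ := h
    have hkm := k.isLt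
    have e1 : |(-(k : ℕ) : ℤ)| ≤ m + D := by rw [abs_le]; constructor <;> omega
    have e2 : |(-(k : ℕ) + D : ℤ)| ≤ m + D := by rw [abs_le]; constructor <;> omega
    rw [sub_eq_add_neg] at hk
    have hk' := (key _ e1).1 hk
    have h1 := frameMap_of_act (U := U) (g := g) (D := D) hsep x _ hk k
    have h2 := frameMap_of_act (U := U) (g := g) (D := D) hsep y _ hk' k
    rw [neg_add_cancel_right] at h1 h2
    rw [h1, h2, add_assoc, add_assoc, hcells _ e1, hcells _ e2]
    rw [if_congr (key _ e2) rfl rfl]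
  · have h' : ¬ ∃ k : Fin m, act y (j - (k : ℕ)) := by
      rintro ⟨k, hk⟩
      refine h ⟨k, ?_⟩
      have hkm := k.isLt
      rw [sub_eq_add_neg] at hk ⊢
      exact (key _ (by rw [abs_le]; constructor <;> omega)).2 hk
    rw [frameMap_of_not x i h, frameMap_of_not y j h']
    have := hxy 0 (by rw [abs_zero]; positivity)
    simpa using congrArg g this

/-- The map computed by a chain of frames. -/
theorem cells_iterate_of_chain {x : ℤ → A} {o : ℤ}
    (hsep : ∀ x i j, act x i → act x j → i < j → i + m ≤ j)
    (hx : ∀ t : ℕ, ∀ i : ℤ, act ((frameMap U act g D)^[t] x) (o + i * D)) (t : ℕ) (i : ℤ) :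
    cells m ((frameMap U act g D)^[t + 1] x) (o + i * D) =
      U (cells m ((frameMap U act g D)^[t] x) (o + i * D))
        (some (cells m ((frameMap U act g D)^[t] x) (o + (i + 1) * D))) := by
  classical
  rw [Function.iterate_succ_apply', cells_frameMap hsep _ _ (hx t i)]
  have e : o + i * D + D = o + (i + 1) * D := by ring
  rw [e, if_pos (hx t (i + 1))]

/-- If the frames are separated and do not change after one step, and if both the frame update and
the background letter map only produce columns in `S`, then the trace of the resulting cellular
automaton reaches `S` in two steps. -/
theorem exists_of_frames {S : Set (ℕ → A)} (hS : shift '' S = S)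
    (hsep : ∀ x i j, act x i → act x j → i < j → i + m ≤ j) (hD : 0 ≤ D)
    (hact : ∃ r : ℕ, ∀ x y i j, (∀ l : ℤ, |l| ≤ r → x (i + l) = y (j + l)) → act x i → act y j)
    (hkeep : ∀ x i, act x i → act (frameMap U act g D x) i)
    (hcreate : ∀ x i, act (frameMap U act g D (frameMap U act g D x)) i →
      act (frameMap U act g D x) i)
    (hg : ∀ a, (fun t => g^[t + 1] a) ∈ S)
    (hU : ∀ (V : ℕ → Fin m → A) (I : ℕ → Option (Fin m → A)),
      (∀ t, V (t + 1) = U (V t) (I t)) → ∀ k, (fun t => V (t + 1) k) ∈ S)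
    (good : (Fin m → A) → Prop)
    (hplace : ∀ v : ℤ → Fin m → A, (∀ i, good (v i)) →
      ∃ x o, ∀ i : ℤ, act x (o + i * D) ∧ cells m x (o + i * D) = v i)
    (hUS : ∀ z ∈ S, ∃ (v : ℤ → Fin m → A) (k : Fin m), (∀ i, good (v i)) ∧
      ∀ V : ℕ → ℤ → Fin m → A, V 0 = v → (∀ t i, V (t + 1) i = U (V t i) (some (V t (i + 1)))) →
        ∀ t, V (t + 1) 0 k = z t) :
    ∃ F : CellularAutomaton A, shift^[2] '' F.trace = S := by
  classical
  obtain ⟨r, hr⟩ := hact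
  obtain ⟨F, hF⟩ := exists_cellularAutomaton _ _
    (frameMap_local (U := U) (g := g) hsep hD r hr)
  refine ⟨F, Set.Subset.antisymm ?_ ?_⟩
  · rintro _ ⟨_, ⟨x, rfl⟩, rfl⟩
    rw [hF]
    set Φ := frameMap U act g D with hΦ
    -- The set of frames is frozen from time 1 on, so a cell either stays in one frame or obeys `g`
    -- forever.
    have hst : ∀ t i, act (Φ^[t + 1] x) i ↔ act (Φ x) i := by
      intro t i
      induction t with
      | zero => rfl
      | succ t ih =>
        rw [← ih, Function.iterate_succ_apply', Function.iterate_succ_apply']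
        exact ⟨hcreate _ i, hkeep _ i⟩
    by_cases h : ∃ k : Fin m, act (Φ x) (0 - (k : ℕ))
    · obtain ⟨k, hk⟩ := h
      have := hU (fun t => cells m (Φ^[t + 1] x) (0 - (k : ℕ)))
        (fun t => if act (Φ^[t + 1] x) (0 - (k : ℕ) + D) then
          some (cells m (Φ^[t + 1] x) (0 - (k : ℕ) + D)) else none) (fun t => by
            rw [Function.iterate_succ_apply' Φ (t + 1)]
            exact cells_frameMap hsep _ _ ((hst t _).2 hk)) k
      convert this using 1
      funext t
      rw [shift_iterate_apply]
      simp [cells]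
    · convert hg (Φ x 0) using 1
      funext t
      rw [shift_iterate_apply]
      have : ∀ t, Φ^[t + 1] x 0 = g^[t] (Φ x 0) := by
        intro t
        induction t with
        | zero => rfl
        | succ t ih =>
          rw [Function.iterate_succ_apply' Φ, Function.iterate_succ_apply' g, ← ih]
          refine frameMap_of_not _ _ ?_
          rintro ⟨k, hk⟩
          exact h ⟨k, (hst t _).1 hk⟩
      exact this (t + 1)
  · intro z hz
    -- The frames output from time 1, but the trace is shifted twice; a preimage of `z` fills the
    -- gap.
    obtain ⟨y, hy, hyz⟩ := exists_tail_eq hS hz 1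
    obtain ⟨v, k, hv, hV⟩ := hUS y hy
    obtain ⟨x, o, hxo⟩ := hplace v hv
    have hall : ∀ t : ℕ, ∀ i : ℤ, act ((frameMap U act g D)^[t] x) (o + i * D) := by
      intro t i
      induction t with
      | zero => exact (hxo i).1
      | succ t ih => rw [Function.iterate_succ_apply']; exact hkeep _ _ ih
    have hx := hV (fun t i => cells m ((frameMap U act g D)^[t] x) (o + i * D))
      (funext fun i => (hxo i).2) (cells_iterate_of_chain hsep hall)
    obtain ⟨c, hc⟩ : ∃ c : ℤ, o + 0 * D + (k : ℕ) = c := ⟨_, rfl⟩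
    simp only [cells, hc] at hx
    refine ⟨_, ⟨fun j => x (c + j), rfl⟩, ?_⟩
    funext t
    rw [shift_iterate_apply, ← hyz t, ← hx (t + 1), hF]
    have : ∀ t i, (frameMap U act g D)^[t] (fun j => x (c + j)) i =
        (frameMap U act g D)^[t] x (c + i) := by
      intro t
      induction t with
      | zero => intro i; rfl
      | succ t ih =>
        intro i
        rw [Function.iterate_succ_apply', Function.iterate_succ_apply']
        refine frameMap_local hsep hD r hr _ _ _ _ fun l _ => ?_
        rw [ih, add_assoc]
    exact (this _ _).trans (by rw [add_zero])

end Frames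

end TraceCA

namespace TraceCA

/-! ### Periodic layouts of frames -/

section BlockConfiguration

variable {A : Type*} {m : ℕ}

/-- The configuration whose block `[i * (q + m + e), (i + 1) * (q + m + e))` consists of `q`
letters given by `s`, of the word `v i` and of `e` letters given by `s`. -/
def blockConfiguration (q e : ℕ) (s : ℤ → A) (v : ℤ → Fin m → A) (l : ℤ) : A :=
  if h : (q : ℤ) ≤ l % (q + m + e) ∧ l % (q + m + e) < q + m then
    v (l / (q + m + e)) ⟨(l % (q + m + e) - q).toNat, by omega⟩
  else s (l % (q + m + e))

theorem blockConfiguration_apply_word (q e : ℕ) (s : ℤ → A) (v : ℤ → Fin m → A) (i : ℤ)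
    (k : Fin m) : blockConfiguration q e s v (q + i * (q + m + e) + (k : ℕ)) = v i k := by
  have hk := k.isLt
  have e1 : ((q : ℤ) + i * (q + m + e) + (k : ℕ)) % (q + m + e) = q + k := by
    rw [show (q : ℤ) + i * (q + m + e) + (k : ℕ) = q + (k : ℕ) + (q + m + e) * i by ring,
      Int.add_mul_emod_self_left, Int.emod_eq_of_lt] <;> omega
  have e2 : ((q : ℤ) + i * (q + m + e) + (k : ℕ)) / (q + m + e) = i := by
    rw [show (q : ℤ) + i * (q + m + e) + (k : ℕ) = q + (k : ℕ) + (q + m + e) * i by ring,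
      Int.add_mul_ediv_left _ _ (by omega), Int.ediv_eq_zero_of_lt] <;> omega
  rw [blockConfiguration, dif_pos (by omega), e2]
  exact congrArg (v i) (Fin.ext (by simp only; omega))

theorem blockConfiguration_apply_of_not (q e : ℕ) (s : ℤ → A) (v : ℤ → Fin m → A) (i r : ℤ)
    (h0 : 0 ≤ r) (h1 : r < q + m + e) (h : ¬ (q ≤ r ∧ r < q + m)) :
    blockConfiguration q e s v (i * (q + m + e) + r) = s r := by
  have e1 : (i * (q + m + e) + r) % (q + m + e) = r := by
    rw [show i * (q + m + e) + r = r + (q + m + e) * i by ring,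
      Int.add_mul_emod_self_left, Int.emod_eq_of_lt h0 h1]
  rw [blockConfiguration, dif_neg (by omega), e1]

theorem cells_blockConfiguration (q e : ℕ) (s : ℤ → A) (v : ℤ → Fin m → A) (i : ℤ) :
    cells m (blockConfiguration q e s v) (q + i * (q + m + e)) = v i :=
  funext fun k => blockConfiguration_apply_word q e s v i k

end BlockConfiguration

/-! ### Delimiters that follow a cycle of length at least two -/

section Moving

variable {A : Type*} {m : ℕ}

/-- A frame with `m` cells at position `i`, delimited by letters of a cycle `C` of `ξ`. -/
def movingFrame (m : ℕ) (ξ : A → A) (C : Set A) (x : ℤ → A) (i : ℤ) : Prop :=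
  ∃ c ∈ C, (∀ l, i - m - 4 ≤ l → l < i - 1 → x l = c) ∧ x (i - 1) = ξ c ∧ x (i + m) = c ∧
    x (i + m + 1) = ξ c

/-- The run of `m + 3` equal letters before a frame is long enough that a second frame too close to
the first would have a pair `c`, `ξ c` of the first inside its run, forcing `ξ c = c`. -/
theorem movingFrame_separated {ξ : A → A} {C : Set A} (hC : ∀ c ∈ C, ξ c ≠ c) {x : ℤ → A}
    {i j : ℤ} (hi : movingFrame m ξ C x i) (hj : movingFrame m ξ C x j) (hij : i < j) :
    i + 2 * m + 5 ≤ j := by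
  obtain ⟨c, hc, h1, h2, h3, h4⟩ := hi
  obtain ⟨d, hd, h1', h2', h3', h4'⟩ := hj
  by_contra hlt
  rcases le_or_gt (i + m + 3) j with h | h
  · apply hC c hc
    rw [← h4, ← h3, h1' _ (by omega) (by omega), h1' _ (by omega) (by omega)]
  · apply hC c hc
    rw [← h2, ← h1 (i - 2) (by omega) (by omega), h1' (i - 1) (by omega) (by omega),
      h1' (i - 2) (by omega) (by omega)]

theorem movingFrame_local (ξ : A → A) (C : Set A) (x y : ℤ → A) (i j : ℤ)
    (h : ∀ l : ℤ, |l| ≤ (m + 4 : ℕ) → x (i + l) = y (j + l)) (hi : movingFrame m ξ C x i) :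
    movingFrame m ξ C y j := by
  have h' : ∀ l : ℤ, j - (m + 4) ≤ l → l ≤ j + (m + 4) → y l = x (l - j + i) := by
    intro l hl1 hl2
    have := h (l - j) (by rw [abs_le]; push_cast; constructor <;> omega)
    rw [show j + (l - j) = l by ring] at this
    rw [← this]
    congr 1
    ring
  obtain ⟨c, hc, h1, h2, h3, h4⟩ := hi
  refine ⟨c, hc, fun l hl hl' => ?_, ?_, ?_, ?_⟩
  · rw [h' _ (by omega) (by omega)]
    exact h1 _ (by omega) (by omega)
  · rw [h' _ (by omega) (by omega), ← h2]
    congr 1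
    ring
  · rw [h' _ (by omega) (by omega), ← h3]
    congr 1
    ring
  · rw [h' _ (by omega) (by omega), ← h4]
    congr 1
    ring

/-- Realization of `S` by frames that are delimited by a cycle of `ξ` of length at least two. -/
theorem exists_of_cycle {S : Set (ℕ → A)} (hS : shift '' S = S) {ξ : A → A} {b : A} {p : ℕ}
    (hp : 0 < p) (hb : ξ^[p] b = b) (hbS : (fun t => ξ^[t] b) ∈ S) (hne : ξ b ≠ b)
    (U : (Fin m → A) → Option (Fin m → A) → Fin m → A)
    (hU : ∀ (V : ℕ → Fin m → A) (I : ℕ → Option (Fin m → A)),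
      (∀ t, V (t + 1) = U (V t) (I t)) → ∀ k, (fun t => V (t + 1) k) ∈ S)
    (hUS : ∀ z ∈ S, ∃ (v : ℤ → Fin m → A) (k : Fin m),
      ∀ V : ℕ → ℤ → Fin m → A, V 0 = v → (∀ t i, V (t + 1) i = U (V t i) (some (V t (i + 1)))) →
        ∀ t, V (t + 1) 0 k = z t) :
    ∃ F : CellularAutomaton A, shift^[2] '' F.trace = S := by
  classical
  let C : Set A := Set.range fun j => ξ^[j] b
  have hbC : b ∈ C := ⟨0, rfl⟩
  have hξC : ∀ c ∈ C, ξ c ∈ C := by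
    rintro _ ⟨j, rfl⟩
    exact ⟨j + 1, Function.iterate_succ_apply' ξ j b⟩
  have hper : ∀ c ∈ C, ξ^[p] c = c := by
    rintro _ ⟨j, rfl⟩
    simp only
    rw [← Function.iterate_add_apply, add_comm, Function.iterate_add_apply, hb]
  -- `ξ^[p]` is the identity on the cycle. Injectivity is what lets a delimiter pattern be traced
  -- back in time.
  have hinj : Set.InjOn ξ C := by
    intro c hc d hd h
    rw [← hper c hc, ← hper d hd]
    obtain ⟨p, rfl⟩ := Nat.exists_eq_add_of_lt hp
    rw [zero_add, Function.iterate_succ_apply, Function.iterate_succ_apply, h]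
  have hCne : ∀ c ∈ C, ξ c ≠ c := by
    rintro _ ⟨j, rfl⟩
    simp only
    intro h
    apply hne
    have hle : j ≤ p * j := Nat.le_mul_of_pos_left j hp
    have h1 : ξ^[p * j] b = b := by
      rw [mul_comm]
      exact (show Function.IsPeriodicPt ξ p b from hb).const_mul j
    have h2 : ξ^[j] b = b := by
      rw [← Nat.sub_add_cancel hle, Function.iterate_add_apply] at h1
      exact (Function.IsFixedPt.iterate h _).symm.trans h1
    rwa [h2] at h
  -- One step puts every cell outside the frames on the cycle, where its column belongs to S.
  let g : A → A := fun a => if a ∈ C then ξ a else b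
  have hgC : ∀ a, g a ∈ C := by
    intro a
    simp only [g]
    split_ifs with h
    · exact hξC a h
    · exact hbC
  have hgξ : ∀ a ∈ C, g a = ξ a := fun a ha => if_pos ha
  let act := movingFrame m ξ C
  let D : ℤ := ((m + 4 : ℕ) : ℤ) + m + (2 : ℕ)
  have hsep : ∀ x i j, act x i → act x j → i < j → i + 2 * m + 5 ≤ j :=
    fun x i j hi hj hij => movingFrame_separated hCne hi hj hij
  -- the delimiting cells of a frame are not cells of any frame
  have hskel : ∀ x i j l, act x i → act x j →
      ((j - m - 4 ≤ l ∧ l < j) ∨ l = j + m ∨ l = j + m + 1) → ¬ (i ≤ l ∧ l < i + m) := by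
    intro x i j l hi hj hl
    rcases lt_trichotomy i j with h | h | h
    · have := hsep x i j hi hj h
      omega
    · omega
    · have := hsep x j i hj hi h
      omega
  have hstep : ∀ x l, (∀ i, act x i → ¬ (i ≤ l ∧ l < i + m)) → frameMap U act g D x l = g (x l) := by
    intro x l h
    refine frameMap_of_not x l ?_
    rintro ⟨k, hk⟩
    have := k.isLt
    exact h _ hk (by omega)
  have hkeep : ∀ x i, act x i → act (frameMap U act g D x) i := by
    intro x i hi
    obtain ⟨c, hc, h1, h2, h3, h4⟩ := hi
    have hi : act x i := ⟨c, hc, h1, h2, h3, h4⟩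
    refine ⟨ξ c, hξC c hc, fun l hl hl' => ?_, ?_, ?_, ?_⟩
    · rw [hstep x l fun j hj => hskel x j i l hj hi (by omega), h1 l hl hl', hgξ c hc]
    · rw [hstep x _ fun j hj => hskel x j i _ hj hi (by omega), h2, hgξ _ (hξC c hc)]
    · rw [hstep x _ fun j hj => hskel x j i _ hj hi (by omega), h3, hgξ c hc]
    · rw [hstep x _ fun j hj => hskel x j i _ hj hi (by omega), h4, hgξ _ (hξC c hc)]
  refine exists_of_frames (U := U) (act := act) (g := g) (D := D) hS ?_ ?_ ⟨m + 4, ?_⟩ hkeep ?_ ?_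
    hU (fun _ => True) ?_ ?_
  · intro x i j hi hj hij
    have := hsep x i j hi hj hij
    omega
  · positivity
  · exact fun x y i j h hi => movingFrame_local ξ C x y i j h hi
  · intro x' j hj
    set x := frameMap U act g D x' with hx
    -- The delimiters of a new frame lie outside all frames of `x'` and `x`, so in `x` they already
    -- hold cycle letters and then evolve by `ξ`. Pulling the pattern back shows that the frame was
    -- present in `x`.
    by_contra hnj
    have hnot : ∀ i, act x i → ∀ l, ((j - m - 4 ≤ l ∧ l < j) ∨ l = j + m ∨ l = j + m + 1) →
        ¬ (i ≤ l ∧ l < i + m) :=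
      fun i hi l hl => hskel _ i j l (hkeep x i hi) hj hl
    have hxC : ∀ l, ((j - m - 4 ≤ l ∧ l < j) ∨ l = j + m ∨ l = j + m + 1) → x l ∈ C := by
      intro l hl
      rw [hx, hstep x' l fun i hi => hnot i (hkeep x' i hi) l hl]
      exact hgC _
    have hxξ : ∀ l, ((j - m - 4 ≤ l ∧ l < j) ∨ l = j + m ∨ l = j + m + 1) →
        frameMap U act g D x l = ξ (x l) := by
      intro l hl
      rw [hstep x l fun i hi => hnot i hi l hl, hgξ _ (hxC l hl)]
    obtain ⟨c, hc, h1, h2, h3, h4⟩ := hj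
    have hcx : ξ (x (j - 2)) = c := by rw [← hxξ _ (by omega), h1 _ (by omega) (by omega)]
    apply hnj
    refine ⟨x (j - 2), hxC _ (by omega), fun l hl hl' => ?_, ?_, ?_, ?_⟩
    · apply hinj (hxC l (by omega)) (hxC _ (by omega))
      rw [hcx, ← hxξ _ (by omega), h1 l hl hl']
    · apply hinj (hxC _ (by omega)) (hξC _ (hxC _ (by omega)))
      rw [hcx, ← hxξ _ (by omega), h2]
    · apply hinj (hxC _ (by omega)) (hxC _ (by omega))
      rw [hcx, ← hxξ _ (by omega), h3]
    · apply hinj (hxC _ (by omega)) (hξC _ (hxC _ (by omega)))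
      rw [hcx, ← hxξ _ (by omega), h4]
  · intro a
    have h1 : ∀ c ∈ C, ∀ t, g^[t] c = ξ^[t] c ∧ ξ^[t] c ∈ C := by
      intro c hc t
      induction t with
      | zero => exact ⟨rfl, hc⟩
      | succ t ih =>
        rw [Function.iterate_succ_apply', Function.iterate_succ_apply', ih.1, hgξ _ ih.2]
        exact ⟨rfl, hξC _ ih.2⟩
    obtain ⟨j, hj⟩ := hgC a
    convert tail_mem hS hbS j using 1
    funext t
    rw [Function.iterate_succ_apply, (h1 _ (hgC a) t).1, ← hj, Function.iterate_add_apply]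
  · intro v _
    let s : ℤ → A := fun r => if r = (m + 3 : ℕ) ∨ r = 2 * m + 5 then ξ b else b
    refine ⟨blockConfiguration (m + 4) 2 s v, (m + 4 : ℕ), fun i => ⟨⟨b, hbC, ?_, ?_, ?_, ?_⟩,
      cells_blockConfiguration (m + 4) 2 s v i⟩⟩
    · intro l hl hl'
      obtain ⟨r, rfl⟩ : ∃ r, l = i * D + r := ⟨l - i * D, by ring⟩
      rw [blockConfiguration_apply_of_not _ _ _ _ _ _ (by omega) (by omega) (by omega)]
      simp only [s]
      rw [if_neg (by omega)]
    · rw [show ((m + 4 : ℕ) : ℤ) + i * D - 1 = i * D + (m + 3 : ℕ) by push_cast; ring,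
        blockConfiguration_apply_of_not _ _ _ _ _ _ (by omega) (by omega) (by omega)]
      exact if_pos (Or.inl rfl)
    · rw [show ((m + 4 : ℕ) : ℤ) + i * D + m = i * D + (2 * m + 4 : ℕ) by push_cast; ring,
        blockConfiguration_apply_of_not _ _ _ _ _ _ (by omega) (by omega) (by omega)]
      simp only [s]
      rw [if_neg (by omega)]
    · rw [show ((m + 4 : ℕ) : ℤ) + i * D + m + 1 = i * D + (2 * m + 5 : ℕ) by push_cast; ring,
        blockConfiguration_apply_of_not _ _ _ _ _ _ (by omega) (by omega) (by omega)]
      simp only [s]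
      exact if_pos (Or.inr (by push_cast; ring))
  · intro z hz
    obtain ⟨v, k, h⟩ := hUS z hz
    exact ⟨v, k, fun _ => trivial, h⟩

end Moving

end TraceCA

namespace TraceCA

/-! ### Markers on a constant background -/

section Marker

variable {A : Type*} {T : ℕ} {a : A} {w : ℕ → A}

/-- The marker of phase `t`: the cells `2 ^ k` for `k < T` hold the letter `w (t + k)`, all other
cells hold `a`. -/
def marker (T : ℕ) (a : A) (w : ℕ → A) (t : ℕ) (s : ℕ) : A :=
  if s = 2 ^ Nat.log 2 s ∧ Nat.log 2 s < T then w (t + Nat.log 2 s) else a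

theorem marker_two_pow (t : ℕ) {k : ℕ} (hk : k < T) : marker T a w t (2 ^ k) = w (t + k) := by
  have : Nat.log 2 (2 ^ k) = k := Nat.log_pow (by norm_num) k
  rw [marker, this, if_pos ⟨rfl, hk⟩]

theorem exists_of_marker_ne {t s : ℕ} (h : marker T a w t s ≠ a) :
    ∃ k < T, s = 2 ^ k ∧ w (t + k) ≠ a := by
  rw [marker] at h
  split_ifs at h with hs
  · exact ⟨_, hs.2, hs.1, h⟩
  · exact absurd rfl h

theorem marker_mem {S : Set (ℕ → A)} (hS : shift '' S = S) (ha : (fun _ => a) ∈ S) (hw : w ∈ S)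
    (t s : ℕ) : (fun i => marker T a w (t + i) s) ∈ S := by
  by_cases hs : s = 2 ^ Nat.log 2 s ∧ Nat.log 2 s < T
  · convert tail_mem hS hw (t + Nat.log 2 s) using 1
    funext i
    rw [marker, if_pos hs]
    congr 1
    ring
  · convert ha using 1
    funext i
    rw [marker, if_neg hs]

/-- A marker displays one full period of `w`, so its successor depends only on its content, even if
several phases give that content. -/
theorem marker_succ_eq (hT : ∀ t, w (t + T) = w t) (hT0 : 0 < T) {t t' : ℕ}
    (h : ∀ s < 2 ^ (T + 1), marker T a w t s = marker T a w t' s) (s : ℕ) :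
    marker T a w (t + 1) s = marker T a w (t' + 1) s := by
  have h1 : ∀ k < T, w (t + k) = w (t' + k) := by
    intro k hk
    rw [← marker_two_pow (a := a) (w := w) t hk, ← marker_two_pow (a := a) (w := w) t' hk]
    exact h _ (Nat.pow_lt_pow_right (by norm_num) (by omega))
  have h2 : ∀ k ≤ T, w (t + k) = w (t' + k) := by
    intro k hk
    rcases hk.lt_or_eq with hk | rfl
    · exact h1 k hk
    · rw [hT, hT]
      exact h1 0 hT0
  rw [marker, marker]
  split_ifs with hs
  · rw [add_assoc, add_assoc]
    exact h2 _ (by omega)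
  · rfl

/-- The powers of two form a Sidon set: a nonzero difference determines both terms. -/
theorem two_pow_sub_injective {k l k' l' : ℕ} (hkl : k < l)
    (h : (2 : ℤ) ^ l - 2 ^ k = 2 ^ l' - 2 ^ k') : l = l' ∧ k = k' := by
  have hn : 2 ^ l + 2 ^ k' = 2 ^ l' + 2 ^ k := by
    zify
    linarith
  have hpos : ∀ n : ℕ, 0 < 2 ^ n := fun n => by positivity
  have hlt : ∀ {i j : ℕ}, i < j → 2 ^ i * 2 ≤ 2 ^ j := fun {i j} hij => by
    rw [← pow_succ]
    exact Nat.pow_le_pow_right (by norm_num) hij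
  have h1 := hlt hkl
  have hk'l' : k' < l' := by
    by_contra hge
    have := Nat.pow_le_pow_right (n := 2) (by norm_num) (not_lt.1 hge)
    have := hpos k
    omega
  have h2 := hlt hk'l'
  have hl : l = l' := by
    rcases lt_trichotomy l l' with hh | hh | hh
    · have := hlt hh
      have := hpos k
      omega
    · exact hh
    · have := hlt hh
      have := hpos k'
      omega
  subst hl
  refine ⟨rfl, ?_⟩
  have : 2 ^ k' = 2 ^ k := by omega
  exact (Nat.pow_right_injective le_rfl this).symm

/-- A marker at position `i` that is preceded by `q` letters `a`. -/
def markedAt (T : ℕ) (a : A) (w : ℕ → A) (q : ℕ) (x : ℤ → A) (i : ℤ) : Prop :=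
  (∀ l, i - q ≤ l → l < i → x l = a) ∧
    ∃ t, ∀ s : ℕ, s < 2 ^ (T + 1) → x (i + s) = marker T a w t s

/-- Two letters of the first marker other than `a` cannot fall among the letters `a` preceding the
second, so they sit at power-of-two positions in both markers. Their distance determines these
positions, so the markers coincide. -/
theorem markedAt_eq {q : ℕ} {x : ℤ → A} {i j : ℤ}
    (hw : ∀ t, ∃ k l, k < l ∧ l < T ∧ w (t + k) ≠ a ∧ w (t + l) ≠ a)
    (hi : markedAt T a w q x i) (hj : markedAt T a w q x j) (h1 : i ≤ j) (h2 : j < i + q) :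
    i = j := by
  obtain ⟨-, t, ht⟩ := hi
  obtain ⟨ha, t', ht'⟩ := hj
  have hbound : ∀ k < T, 2 ^ k * 4 ≤ 2 ^ (T + 1) := by
    intro k hk
    rw [show 2 ^ k * 4 = 2 ^ (k + 2) by ring]
    exact Nat.pow_le_pow_right (by norm_num) (by omega)
  -- a letter of the first marker that is not `a` belongs to the second marker
  have key : ∀ k < T, w (t + k) ≠ a → ∃ k', (i : ℤ) + 2 ^ k = j + 2 ^ k' := by
    intro k hk hne
    obtain ⟨P, hP⟩ : ∃ P, P = 2 ^ k := ⟨_, rfl⟩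
    have hPpos : 0 < P := hP ▸ by positivity
    have hb : P * 4 ≤ 2 ^ (T + 1) := hP ▸ hbound k hk
    have hx : x (i + (P : ℕ)) ≠ a := by
      rwa [ht P (by omega), hP, marker_two_pow t hk]
    have hge : j ≤ i + (P : ℕ) := by
      by_contra hlt
      exact hx (ha _ (by omega) (by omega))
    obtain ⟨s, hs⟩ := Int.eq_ofNat_of_zero_le (show 0 ≤ i + (P : ℕ) - j by omega)
    have hs' : i + (P : ℕ) = j + (s : ℤ) := by omega
    rw [hs', ht' s (by omega)] at hx
    obtain ⟨k', _, rfl, _⟩ := exists_of_marker_ne hx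
    exact ⟨k', by rw [hP] at hs'; exact_mod_cast hs'⟩
  obtain ⟨k, l, hkl, hl, hka, hla⟩ := hw t
  obtain ⟨k', hk'⟩ := key k (by omega) hka
  obtain ⟨l', hl'⟩ := key l hl hla
  obtain ⟨-, rfl⟩ := two_pow_sub_injective (k' := k') (l' := l') hkl (by linarith)
  linarith

theorem markedAt_local (q : ℕ) (x y : ℤ → A) (i j : ℤ)
    (h : ∀ l : ℤ, |l| ≤ (q + 2 ^ (T + 1) : ℕ) → x (i + l) = y (j + l))
    (hi : markedAt T a w q x i) : markedAt T a w q y j := by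
  obtain ⟨h1, t, h2⟩ := hi
  obtain ⟨M, hM⟩ : ∃ M, M = 2 ^ (T + 1) := ⟨_, rfl⟩
  rw [← hM] at h h2
  refine ⟨fun l hl hl' => ?_, t, fun s hs => ?_⟩
  · have := h (l - j) (by rw [abs_le]; push_cast; constructor <;> omega)
    rw [show j + (l - j) = l by ring] at this
    rw [← this]
    exact h1 _ (by omega) (by omega)
  · rw [← hM] at hs
    rw [← h s (by rw [abs_le]; constructor <;> omega)]
    exact h2 s hs

/-- A marked position without other marked positions within distance `r`. -/
def isolatedMarkedAt (T : ℕ) (a : A) (w : ℕ → A) (q r : ℕ) (x : ℤ → A) (i : ℤ) : Prop :=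
  markedAt T a w q x i ∧ ∀ j, markedAt T a w q x j → |j - i| < r → j = i

theorem isolatedMarkedAt_local (q r : ℕ) (x y : ℤ → A) (i j : ℤ)
    (h : ∀ l : ℤ, |l| ≤ (q + 2 ^ (T + 1) + r : ℕ) → x (i + l) = y (j + l))
    (hi : isolatedMarkedAt T a w q r x i) : isolatedMarkedAt T a w q r y j := by
  refine ⟨markedAt_local q x y i j (fun l hl => h l (by push_cast at hl ⊢; omega)) hi.1,
    fun j' hj' hlt => ?_⟩
  rw [abs_lt] at hlt
  have := hi.2 (i + (j' - j)) (markedAt_local q y x j' _ (fun l hl => ?_) hj')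
    (by rw [abs_lt]; constructor <;> omega)
  · omega
  · rw [abs_le] at hl
    push_cast at hl
    have := h (j' - j + l) (by rw [abs_le]; push_cast; constructor <;> omega)
    rw [show j' + l = j + (j' - j + l) by ring, ← this]
    congr 1
    ring

/-- In a configuration that is made of sparse frames beginning with a marker and of letters `a`,
the marked positions are those of the frames. -/
theorem markedAt_iff_of_sparse {m q : ℕ} (hm : 2 ^ (T + 1) ≤ m) (hq : m ≤ q)
    (hw : ∀ t, ∃ k l, k < l ∧ l < T ∧ w (t + k) ≠ a ∧ w (t + l) ≠ a) {x : ℤ → A} {I : Set ℤ}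
    (hI : ∀ i ∈ I, ∀ j ∈ I, i < j → i + q + m ≤ j)
    (hmark : ∀ i ∈ I, ∃ t, ∀ s : ℕ, s < 2 ^ (T + 1) → x (i + s) = marker T a w t s)
    (ha : ∀ l, (∀ i ∈ I, ¬ (i ≤ l ∧ l < i + m)) → x l = a) (j : ℤ) :
    markedAt T a w q x j ↔ j ∈ I := by
  have hback : ∀ i ∈ I, markedAt T a w q x i := by
    intro i hi
    refine ⟨fun l hl hl' => ha l fun i' hi' => ?_, hmark i hi⟩
    rcases lt_trichotomy i i' with h | h | h
    · omega
    · omega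
    · have := hI i' hi' i hi h
      omega
  refine ⟨fun hj => ?_, hback j⟩
  -- A stray mark would show a letter other than `a`. That letter lies in a genuine frame, which is
  -- then too close to the mark to differ from it.
  obtain ⟨t, ht⟩ := hj.2
  obtain ⟨k, l, hkl, hl, hka, hla⟩ := hw t
  obtain ⟨P, hP⟩ : ∃ P, P = 2 ^ k := ⟨_, rfl⟩
  have hb : P < 2 ^ (T + 1) := hP ▸ Nat.pow_lt_pow_right (by norm_num) (by omega)
  have hPpos : 0 < P := hP ▸ by positivity
  have hx : x (j + P) ≠ a := by
    rwa [ht _ hb, hP, marker_two_pow t (by omega)]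
  obtain ⟨i, hi, hi'⟩ : ∃ i ∈ I, i ≤ j + (P : ℤ) ∧ j + (P : ℤ) < i + m := by
    by_contra hno
    push Not at hno
    exact hx (ha _ fun i hi h => absurd h.2 (not_lt.2 (hno i hi h.1)))
  rcases le_total i j with h | h
  · rw [← markedAt_eq hw (hback i hi) hj h (by omega)]
    exact hi
  · rw [markedAt_eq hw hj (hback i hi) h (by omega)]
    exact hi

/-- Isolation at distance `q + m` leaves room for the `q` letters `a` between frames; conversely,
frames with this spacing are automatically isolated. -/
theorem isolatedMarkedAt_iff_of_sparse {m q : ℕ} (hm : 2 ^ (T + 1) ≤ m) (hq : m ≤ q)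
    (hw : ∀ t, ∃ k l, k < l ∧ l < T ∧ w (t + k) ≠ a ∧ w (t + l) ≠ a) {x : ℤ → A} {I : Set ℤ}
    (hI : ∀ i ∈ I, ∀ j ∈ I, i < j → i + q + m ≤ j)
    (hmark : ∀ i ∈ I, ∃ t, ∀ s : ℕ, s < 2 ^ (T + 1) → x (i + s) = marker T a w t s)
    (ha : ∀ l, (∀ i ∈ I, ¬ (i ≤ l ∧ l < i + m)) → x l = a) (j : ℤ) :
    isolatedMarkedAt T a w q (q + m) x j ↔ j ∈ I := by
  have key := markedAt_iff_of_sparse hm hq hw hI hmark ha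
  refine ⟨fun h => (key j).1 h.1, fun h => ⟨(key j).2 h, fun j' hj' hlt => ?_⟩⟩
  rw [key] at hj'
  rw [abs_lt] at hlt
  push_cast at hlt
  rcases lt_trichotomy j j' with hh | hh | hh
  · have := hI j h j' hj' hh
    omega
  · exact hh.symm
  · have := hI j' hj' j h hh
    omega

end Marker

end TraceCA

namespace TraceCA

/-! ### Frames delimited by markers -/

section Fixed

variable {A : Type*} {m : ℕ}

open Classical in
/-- The phase of a marker is incremented, and anything else is replaced by a marker. -/
noncomputable def markerStep {M : ℕ} (T : ℕ) (a : A) (w : ℕ → A) (u : Fin M → A) :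
    Fin M → A :=
  if h : ∃ t, u = fun s : Fin M => marker T a w t s then fun s : Fin M => marker T a w (h.choose + 1) s
  else fun s : Fin M => marker T a w 0 s

theorem exists_markerStep_eq {M : ℕ} (T : ℕ) (a : A) (w : ℕ → A) (u : Fin M → A) :
    ∃ t, markerStep T a w u = fun s : Fin M => marker T a w t s := by
  rw [markerStep]
  split_ifs
  · exact ⟨_, rfl⟩
  · exact ⟨_, rfl⟩

/-- The phase chosen by `markerStep` may differ from `t`, but by `marker_succ_eq` the next marker
does not depend on it. -/
theorem markerStep_marker {M T : ℕ} (hM : M = 2 ^ (T + 1)) {a : A} {w : ℕ → A}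
    (hT : ∀ t, w (t + T) = w t) (hT0 : 0 < T)
    (t : ℕ) : markerStep T a w (fun s : Fin M => marker T a w t s) = fun s : Fin M => marker T a w (t + 1) s := by
  have h : ∃ t', (fun s : Fin M => marker T a w t s) = fun s : Fin M => marker T a w t' s :=
    ⟨t, rfl⟩
  rw [markerStep, dif_pos h]
  funext s
  exact marker_succ_eq hT hT0 (fun s hs => (congrFun h.choose_spec ⟨s, hM ▸ hs⟩).symm) s

/-- The frame update `U` with an additional marker. -/
noncomputable def markedUpdate {M : ℕ} (T : ℕ) (a : A) (w : ℕ → A)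
    (U : (Fin m → A) → Option (Fin m → A) → Fin m → A) (v : Fin (M + m) → A)
    (inp : Option (Fin (M + m) → A)) : Fin (M + m) → A :=
  Fin.append (markerStep T a w fun s => v (Fin.castAdd m s))
    (U (fun k => v (Fin.natAdd _ k)) (inp.map fun v' k => v' (Fin.natAdd _ k)))

/-- Realization of `S` by frames that are delimited by a constant background `a` and by markers
evolving along a periodic sequence `w`. -/
theorem exists_of_fixed {S : Set (ℕ → A)} (hS : shift '' S = S) {a : A} (ha : (fun _ => a) ∈ S)
    {w : ℕ → A} (hw : w ∈ S) {T : ℕ} (hT : ∀ t, w (t + T) = w t)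
    (hw2 : ∀ t, ∃ k l, k < l ∧ l < T ∧ w (t + k) ≠ a ∧ w (t + l) ≠ a)
    (U : (Fin m → A) → Option (Fin m → A) → Fin m → A)
    (hU : ∀ (V : ℕ → Fin m → A) (I : ℕ → Option (Fin m → A)),
      (∀ t, V (t + 1) = U (V t) (I t)) → ∀ k, (fun t => V (t + 1) k) ∈ S)
    (hUS : ∀ z ∈ S, ∃ (v : ℤ → Fin m → A) (k : Fin m),
      ∀ V : ℕ → ℤ → Fin m → A, V 0 = v → (∀ t i, V (t + 1) i = U (V t i) (some (V t (i + 1)))) →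
        ∀ t, V (t + 1) 0 k = z t) :
    ∃ F : CellularAutomaton A, shift^[2] '' F.trace = S := by
  classical
  have hT0 : 0 < T := by
    obtain ⟨k, l, -, hl, -⟩ := hw2 0
    omega
  obtain ⟨M, hM⟩ : ∃ M, M = 2 ^ (T + 1) := ⟨_, rfl⟩
  have hM0 : 0 < M := hM ▸ by positivity
  have hmq : 2 ^ (T + 1) ≤ M + m := by omega
  let act := isolatedMarkedAt T a w (M + m) (M + m + (M + m))
  let D : ℤ := ((M + m : ℕ) : ℤ) + (M + m : ℕ) + (0 : ℕ)
  have hD' : D = 2 * M + 2 * m := by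
    simp only [D]
    push_cast
    ring
  let U' := markedUpdate (M := M) T a w U
  have hsep : ∀ x i j, act x i → act x j → i < j → i + (M + m : ℕ) + (M + m : ℕ) ≤ j := by
    intro x i j hi hj hij
    by_contra hlt
    have := hi.2 j hj.1 (by rw [abs_lt]; push_cast; constructor <;> omega)
    omega
  have hmarker : ∀ v inp, ∃ t, ∀ s (hs : s < M),
      U' v inp ⟨s, by omega⟩ = marker T a w t s := by
    intro v inp
    obtain ⟨t, ht⟩ := exists_markerStep_eq T a w fun s => v (Fin.castAdd m s)
    refine ⟨t, fun s hs => ?_⟩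
    have : U' v inp (Fin.castAdd m ⟨s, hs⟩) = _ := Fin.append_left _ _ _
    rw [ht] at this
    exact this
  have hsep' : ∀ x i j, act x i → act x j → i < j → i + (M + m : ℕ) ≤ j := by
    intro x i j hi hj hij
    have := hsep x i j hi hj hij
    omega
  -- The image of any configuration consists of spaced frames beginning with markers and of letters
  -- `a`, so the sparse criterion applies already after one step.
  have hstep : ∀ x i, act (frameMap U' act (fun _ => a) D x) i ↔ act x i := by
    intro x i
    refine isolatedMarkedAt_iff_of_sparse (I := {i | act x i}) hmq le_rfl hw2
      (fun i hi j hj hij => hsep x i j hi hj hij) ?_ ?_ i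
    · intro i hi
      have hc := cells_frameMap (U := U') (g := fun _ => a) (D := D) hsep' x i hi
      obtain ⟨t, ht⟩ := hmarker (cells (M + m) x i)
        (if act x (i + D) then some (cells (M + m) x (i + D)) else none)
      refine ⟨t, fun s hs => ?_⟩
      rw [← ht s (hM ▸ hs), ← hc]
      rfl
    · intro l hl
      refine frameMap_of_not x l ?_
      rintro ⟨k, hk⟩
      have := k.isLt
      exact hl _ hk (by omega)
  refine exists_of_frames (U := U') (act := act) (g := fun _ => a) (D := D) hS hsep'
    (by positivity) ⟨_, fun x y i j h hi => isolatedMarkedAt_local (M + m) (M + m + (M + m)) x y i j h hi⟩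
    (fun x i => (hstep x i).2) (fun x i => (hstep _ i).1) ?_ ?_
    (fun v => ∃ t, ∀ s (hs : s < M), v ⟨s, by omega⟩ = marker T a w t s) ?_ ?_
  · intro c
    convert ha using 1
    funext t
    rw [Function.iterate_succ_apply']
  · intro V I hV k
    refine Fin.addCases (fun s => ?_) (fun k => ?_) k
    · have h1 : ∀ t, (fun s => V (t + 1) (Fin.castAdd m s)) =
          markerStep T a w fun s => V t (Fin.castAdd m s) := by
        intro t
        funext s
        rw [hV t]
        exact Fin.append_left _ _ _
      obtain ⟨t₀, ht₀⟩ := exists_markerStep_eq T a w fun s => V 0 (Fin.castAdd m s)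
      have h2 : ∀ t, (fun s => V (t + 1) (Fin.castAdd m s)) = fun s : Fin M => marker T a w (t₀ + t) s := by
        intro t
        induction t with
        | zero => rw [h1, ht₀]; rfl
        | succ t ih => rw [h1, ih, markerStep_marker hM hT hT0]; rfl
      convert marker_mem (T := T) hS ha hw t₀ s using 1
      funext t
      exact congrFun (h2 t) s
    · refine hU (fun t k => V t (Fin.natAdd _ k))
        (fun t => (I t).map fun v' k => v' (Fin.natAdd _ k)) (fun t => ?_) k
      funext k
      rw [hV t]
      exact Fin.append_right _ _ _
  · intro v hv
    have hcells := cells_blockConfiguration (m := M + m) (M + m) 0 (fun _ => a) v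
    refine ⟨blockConfiguration (M + m) 0 (fun _ => a) v, (M + m : ℕ), fun i => ⟨?_, hcells i⟩⟩
    refine (isolatedMarkedAt_iff_of_sparse (I := {j | ∃ i : ℤ, j = (M + m : ℕ) + i * D}) hmq le_rfl hw2
      ?_ ?_ ?_ _).2 ⟨i, rfl⟩
    · rintro _ ⟨i, rfl⟩ _ ⟨j, rfl⟩ hij
      have hD : 0 ≤ D := by positivity
      have hij' : i < j := by
        by_contra h
        have := mul_le_mul_of_nonneg_right (not_lt.1 h) hD
        omega
      have := mul_le_mul_of_nonneg_right (Int.add_one_le_iff.2 hij') hD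
      rw [add_mul, one_mul] at this
      omega
    · rintro _ ⟨i, rfl⟩
      obtain ⟨t, ht⟩ := hv i
      refine ⟨t, fun s hs => ?_⟩
      rw [← ht s (hM ▸ hs), ← hcells i]
      rfl
    · intro l hl
      have hD0 : D ≠ 0 := by omega
      have h1 := Int.emod_add_mul_ediv l D
      have h2 := Int.emod_nonneg l hD0
      have h3 := Int.emod_lt_of_pos l (show 0 < D by omega)
      rw [mul_comm] at h1
      have h4 := hl _ ⟨l / D, rfl⟩
      have h5 := blockConfiguration_apply_of_not (M + m) 0 (fun _ => a) v (l / D) _ h2 h3 (by omega)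
      rwa [show l / D * D + l % D = l by linarith] at h5
  · intro z hz
    obtain ⟨v, k, h⟩ := hUS z hz
    refine ⟨fun i => Fin.append (fun s : Fin M => marker T a w 0 s) (v i), Fin.natAdd _ k,
      fun i => ⟨0, fun s hs => Fin.append_left _ _ ⟨s, hs⟩⟩, fun V hV0 hV t => ?_⟩
    refine h (fun t i k => V t i (Fin.natAdd _ k)) ?_ ?_ t
    · funext i k
      rw [hV0]
      exact Fin.append_right _ _ _
    · intro t i
      funext k
      rw [hV t i]
      exact Fin.append_right _ _ _

end Fixed

end TraceCA

namespace TraceCA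

/-! ### Shift registers -/

section Register

variable {B : Type*} {n : ℕ}

/-- The factor of length `n` of `η` at position `t`. -/
def window (n : ℕ) (η : ℕ → B) (t : ℕ) : Fin n → B := fun i => η (t + i)

/-- The sequences all of whose factors of length `n` belong to `W`. -/
def wordShift (W : Set (Fin n → B)) : Set (ℕ → B) := {η | ∀ t, window n η t ∈ W}

theorem tail_mem_wordShift {W : Set (Fin n → B)} {η : ℕ → B} (hη : η ∈ wordShift W) (j : ℕ) :
    (fun i => η (j + i)) ∈ wordShift W := by
  intro t
  convert hη (j + t) using 1
  funext i
  simp only [window]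
  congr 1
  ring

/-- The word `y` followed by the letter `b` is a prefix of an element of the shift defined by
`W`. -/
def Extends (W : Set (Fin (n + 2) → B)) (y : Fin (n + 1) → B) (b : B) : Prop :=
  ∃ η ∈ wordShift W, window (n + 1) η 0 = y ∧ η (n + 1) = b

/-- Removal of the first letter of `y` and addition of the last letter `b`. -/
def push (y : Fin (n + 1) → B) (b : B) : Fin (n + 1) → B :=
  fun r => if h : (r : ℕ) + 1 < n + 1 then y ⟨r + 1, h⟩ else b

/-- The witness in `Extends` is an infinite word, so its following letter continues the register:
there are no dead ends. -/
theorem Extends.push {W : Set (Fin (n + 2) → B)} {y : Fin (n + 1) → B} {b : B}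
    (h : Extends W y b) : ∃ b', Extends W (push y b) b' := by
  obtain ⟨η, hη, rfl, rfl⟩ := h
  refine ⟨_, fun i => η (1 + i), tail_mem_wordShift hη 1, ?_, rfl⟩
  funext r
  simp only [TraceCA.push, window]
  split_ifs with hr
  · congr 1
    ring
  · congr 1
    omega

/-- Successive registers overlap, so they are the windows of a single sequence; a register together
with its pushed letter is a factor of length `n + 2` in `W`. -/
theorem mem_wordShift_of_push {W : Set (Fin (n + 2) → B)} (y : ℕ → Fin (n + 1) → B) (b : ℕ → B)
    (hb : ∀ t, Extends W (y t) (b t)) (hy : ∀ t, y (t + 1) = push (y t) (b t)) :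
    (fun t => y t 0) ∈ wordShift W ∧ ∀ t, window (n + 1) (fun t => y t 0) t = y t := by
  have h1 : ∀ r (hr : r < n + 1) t, y t ⟨r, hr⟩ = y (t + r) 0 := by
    intro r
    induction r with
    | zero => intro _ t; rfl
    | succ r ih =>
      intro hr t
      have := ih (by omega) (t + 1)
      rw [hy t, push, dif_pos (by simpa using hr)] at this
      rw [this]
      congr 1
      ring
  have h2 : ∀ t, b t = y (t + (n + 1)) 0 := by
    intro t
    have := h1 n (by omega) (t + 1)
    rw [hy t, push, dif_neg (by simp)] at this
    rw [this]
    congr 1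
    ring
  refine ⟨fun t => ?_, fun t => funext fun r => (h1 r r.isLt t).symm⟩
  obtain ⟨η, hη, h3, h4⟩ := hb t
  convert hη 0 using 1
  funext i
  simp only [window, zero_add]
  rcases Nat.lt_succ_iff_lt_or_eq.1 i.isLt with hi | hi
  · rw [← h1 i hi t, ← h3]
    simp [window]
  · rw [hi, ← h2, ← h4]

open Classical in
/-- The letter pushed by a register with content `y` that receives `inp`: the received letter if it
extends `y`, and otherwise any letter that does. -/
noncomputable def nextLetter (W : Set (Fin (n + 2) → B)) (b₀ : B) (y : Fin (n + 1) → B)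
    (inp : Option B) : B :=
  if h : ∃ b, inp = some b ∧ Extends W y b then h.choose
  else if h : ∃ b, Extends W y b then h.choose else b₀

theorem extends_nextLetter {W : Set (Fin (n + 2) → B)} (b₀ : B) {y : Fin (n + 1) → B}
    (inp : Option B) (hy : ∃ b, Extends W y b) : Extends W y (nextLetter W b₀ y inp) := by
  rw [nextLetter]
  split_ifs with h
  · exact h.choose_spec.2
  · exact hy.choose_spec

theorem nextLetter_some {W : Set (Fin (n + 2) → B)} (b₀ : B) {y : Fin (n + 1) → B} {b : B}
    (h : Extends W y b) : nextLetter W b₀ y (some b) = b := by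
  have h' : ∃ b', some b = some b' ∧ Extends W y b' := ⟨b, rfl, h⟩
  rw [nextLetter, dif_pos h']
  exact (Option.some.inj h'.choose_spec.1).symm

end Register

/-! ### From a multi-track subshift of finite type to a frame update -/

section Update

variable {A : Type*}

/-- A subshift of finite type over a product alphabet, all of whose tracks lie in `S`, together
with a sliding block map onto `S`, yields a frame update that produces exactly `S`. -/
theorem exists_update {S : Set (ℕ → A)} (hne : S.Nonempty) {K : Type*} [Finite K]
    {n : ℕ} (W : Set (Fin (n + 2) → K → A)) (π : (Fin (n + 1) → K → A) → A)
    (htrack : ∀ η ∈ wordShift W, ∀ j, (fun t => η t j) ∈ S)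
    (hπ : ∀ η ∈ wordShift W, (fun t => π (window (n + 1) η t)) ∈ S)
    (honto : ∀ z ∈ S, ∃ η ∈ wordShift W, ∀ t, π (window (n + 1) η t) = z t) :
    ∃ (m : ℕ) (U : (Fin m → A) → Option (Fin m → A) → Fin m → A),
      (∀ (V : ℕ → Fin m → A) (I : ℕ → Option (Fin m → A)),
        (∀ t, V (t + 1) = U (V t) (I t)) → ∀ k, (fun t => V (t + 1) k) ∈ S) ∧
      ∀ z ∈ S, ∃ (v : ℤ → Fin m → A) (k : Fin m), ∀ V : ℕ → ℤ → Fin m → A, V 0 = v →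
        (∀ t i, V (t + 1) i = U (V t i) (some (V t (i + 1)))) → ∀ t, V (t + 1) 0 k = z t := by
  classical
  obtain ⟨z₀, hz₀⟩ := hne
  obtain ⟨η₀, hη₀, -⟩ := honto z₀ hz₀
  have ext₀ : ∀ η ∈ wordShift W, ∀ t, Extends W (window (n + 1) η t) (η (t + (n + 1))) :=
    fun η hη t => ⟨_, tail_mem_wordShift hη t, by funext i; simp [window], rfl⟩
  -- One cell per register position and track, plus the output cell `none`.
  obtain ⟨m, ⟨e⟩⟩ := Finite.exists_equiv_fin (Option (Fin (n + 1) × K))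
  let dec : (Fin m → A) → Fin (n + 1) → K → A := fun v r j => v (e (some (r, j)))
  -- Resets a register without continuation; this can matter only at time 0, since pushing preserves
  -- extendability.
  let fix : (Fin (n + 1) → K → A) → Fin (n + 1) → K → A :=
    fun y => if ∃ b, Extends W y b then y else window (n + 1) η₀ 0
  have hfix : ∀ y, ∃ b, Extends W (fix y) b := by
    intro y
    simp only [fix]
    split_ifs with h
    · exact h
    · exact ⟨_, ext₀ η₀ hη₀ 0⟩
  have hfix' : ∀ y, (∃ b, Extends W y b) → fix y = y := fun y hy => if_pos hy
  let nxt : (Fin m → A) → Option (Fin m → A) → K → A :=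
    fun v inp => nextLetter W (η₀ 0) (fix (dec v)) (inp.map fun v' => dec v' 0)
  let U : (Fin m → A) → Option (Fin m → A) → Fin m → A := fun v inp c =>
    match e.symm c with
    | none => π (fix (dec v))
    | some (r, j) => push (fix (dec v)) (nxt v inp) r j
  have hU0 : ∀ v inp, U v inp (e none) = π (fix (dec v)) := by
    intro v inp
    simp only [U, Equiv.symm_apply_apply]
  have hU1 : ∀ v inp, dec (U v inp) = push (fix (dec v)) (nxt v inp) := by
    intro v inp
    funext r j
    simp only [dec, U, Equiv.symm_apply_apply]
  have hext : ∀ v inp, Extends W (fix (dec v)) (nxt v inp) := fun v inp =>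
    extends_nextLetter _ _ (hfix _)
  refine ⟨m, U, fun V I hV k => ?_, fun z hz => ?_⟩
  · obtain ⟨hη, hwin⟩ := mem_wordShift_of_push (fun t => fix (dec (V t))) (fun t => nxt (V t) (I t))
      (fun t => hext _ _) (fun t => by
        rw [hV t, hU1]
        exact hfix' _ (hext _ _).push)
    set η : ℕ → K → A := fun t => fix (dec (V t)) 0
    obtain ⟨c, rfl⟩ := e.surjective k
    rcases c with _ | ⟨r, j⟩
    · convert hπ η hη using 1
      funext t
      rw [hV t, hU0, hwin t]
    · convert htrack _ (tail_mem_wordShift hη (1 + r)) j using 1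
      funext t
      have h1 : dec (V (t + 1)) = fix (dec (V (t + 1))) := by
        rw [hV t, hU1, hfix' _ (hext _ _).push]
      have h2 := congrFun (congrFun (hwin (t + 1)) r) j
      rw [← h1] at h2
      refine h2.symm.trans ?_
      rw [window, show t + 1 + (r : ℕ) = 1 + r + t by ring]
  · obtain ⟨η, hη, hz⟩ := honto z hz
    -- Frame `i` starts with the factor of `η` at `i * (n + 1)`, so the first register letter of
    -- frame `i + 1` is always the one that frame `i` has to push. Frames of negative index never
    -- influence frame 0.
    let v : ℤ → Fin m → A := fun i c =>
      match e.symm c with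
      | none => z 0
      | some (r, j) => η (i.toNat * (n + 1) + r) j
    have hv : ∀ i, dec (v i) = window (n + 1) η (i.toNat * (n + 1)) := by
      intro i
      funext r j
      simp only [dec, v, Equiv.symm_apply_apply, window]
    refine ⟨v, e none, fun V hV0 hV => ?_⟩
    have key : ∀ t (i : ℕ), dec (V t i) = window (n + 1) η (t + i * (n + 1)) := by
      intro t
      induction t with
      | zero =>
        intro i
        rw [hV0, hv, zero_add, Int.toNat_natCast]
      | succ t ih =>
        intro i
        have hx : Extends W (dec (V t i)) (η (t + i * (n + 1) + (n + 1))) := by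
          rw [ih]
          exact ext₀ η hη _
        have hn : nxt (V t i) (some (V t (i + 1))) = η (t + i * (n + 1) + (n + 1)) := by
          have h1 : dec (V t ((i : ℤ) + 1)) 0 = η (t + i * (n + 1) + (n + 1)) := by
            have := ih (i + 1)
            push_cast at this
            rw [this]
            simp only [window]
            congr 1
            simp
            ring
          simp only [nxt, Option.map_some, h1]
          rw [hfix' _ ⟨_, hx⟩, nextLetter_some _ hx]
        rw [hV, hU1, hn, hfix' _ ⟨_, hx⟩, ih]
        funext r
        simp only [push, window]
        split_ifs with hr
        · congr 1
          ring
        · congr 1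
          omega
    intro t
    have h0 := key t 0
    rw [zero_mul, add_zero, Nat.cast_zero] at h0
    rw [hV, hU0, h0, hfix' _ ⟨_, ext₀ η hη t⟩, hz]

end Update

end TraceCA

namespace TraceCA

universe u

/-! ### Regular languages: free pairs and graph presentations -/

section Languages

variable {A : Type*}

/-- The prefix of length `n` of `z`. -/
def prefixWord (z : ℕ → A) (n : ℕ) : List A := (List.range n).map z

@[simp] theorem length_prefixWord (z : ℕ → A) (n : ℕ) : (prefixWord z n).length = n := by
  simp [prefixWord]

@[simp] theorem getElem_prefixWord (z : ℕ → A) (n i : ℕ) (h : i < (prefixWord z n).length) :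
    (prefixWord z n)[i] = z i := by
  simp [prefixWord]

theorem prefixWord_add (z : ℕ → A) (n k : ℕ) :
    prefixWord z (n + k) = prefixWord z n ++ prefixWord (fun i => z (n + i)) k := by
  simp [prefixWord, List.range_add]

theorem prefixWord_mem_language {S : Set (ℕ → A)} {z : ℕ → A} (hz : z ∈ S) (n : ℕ) :
    prefixWord z n ∈ language S :=
  ⟨z, hz, 0, fun k => by simp⟩

theorem mem_language_of_append {M : Type*} [AddCommMonoidWithOne M] {S : Set (M → A)}
    {x y : List A} (h : x ++ y ∈ language S) : y ∈ language S := by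
  obtain ⟨z, hz, i, hi⟩ := h
  refine ⟨z, hz, i + (x.length : M), fun k => ?_⟩
  have := hi ⟨x.length + k, by simp⟩
  simp only [List.get_eq_getElem] at this ⊢
  rw [List.getElem_append_right (by omega)] at this
  simp only [Nat.add_sub_cancel_left] at this
  rw [← this]
  push_cast
  rw [add_assoc]

theorem mem_of_prefixWord_mem_language [TopologicalSpace A] {S : Set (ℕ → A)} (hcl : IsClosed S)
    (hS : shift '' S = S) {z : ℕ → A} (h : ∀ n, ∃ k, n ≤ k ∧ prefixWord z k ∈ language S) :
    z ∈ S := by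
  refine mem_of_prefixes hcl fun n => ?_
  obtain ⟨k, hk, s, hs, i, hi⟩ := h n
  refine ⟨_, tail_mem hS hs i, fun j hj => ?_⟩
  have := hi ⟨j, by simp; omega⟩
  simpa [add_comm] using this

/-- Two distinct words of the same length that can be freely concatenated in `L`. -/
def HasFreePair (L : Language A) : Prop :=
  ∃ u v : List A, u.length = v.length ∧ u ≠ v ∧
    ∀ l : List Bool, (l.flatMap fun b => if b then v else u) ∈ L

theorem HasFreePair.of_reverse {L : Language A} (h : HasFreePair L.reverse) : HasFreePair L := by
  obtain ⟨u, v, hlen, hne, hmem⟩ := h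
  refine ⟨u.reverse, v.reverse, by simpa using hlen, by simpa using hne, fun l => ?_⟩
  have := hmem l.reverse
  rw [Language.mem_reverse, List.reverse_flatMap, List.reverse_reverse] at this
  convert this using 2
  funext b
  simp only [Function.comp]
  split_ifs <;> rfl

/-- If uncountably many infinite words have all their prefixes in the regular language `L`, then
`L` has a free pair. -/
theorem exists_freePair [Finite A] {L : Language A} (hL : L.IsRegular)
    (hsuffix : ∀ x y : List A, x ++ y ∈ L → y ∈ L) {S : Set (ℕ → A)}
    (hS : ∀ z ∈ S, ∀ n, prefixWord z n ∈ L) (hunc : ¬ S.Countable) : HasFreePair L := by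
  obtain ⟨Q, _, M, rfl⟩ := hL
  -- Each word visits some state infinitely often. Without a free pair, this state and the prefix up
  -- to a first visit would determine the word, leaving only countably many.
  have hq : ∀ z : ℕ → A, ∃ q, ∀ N, ∃ n ≥ N, M.eval (prefixWord z n) = q := by
    intro z
    obtain ⟨q, hq⟩ := Finite.exists_infinite_fiber fun n => M.eval (prefixWord z n)
    refine ⟨q, fun N => ?_⟩
    obtain ⟨n, hn, hN⟩ := (Set.infinite_coe_iff.1 hq).exists_gt N
    exact ⟨n, hN.le, hn⟩
  choose q hq using hq
  choose n₀ _ hn₀ using fun z => hq z 0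
  by_contra hno
  apply hunc
  refine Set.MapsTo.countable_of_injOn (t := (Set.univ : Set (Q × List A)))
    (f := fun z => (q z, prefixWord z (n₀ z))) (fun _ _ => trivial) ?_ Set.countable_univ
  intro z hz z' hz' heq
  by_contra hne
  apply hno
  obtain ⟨hqq, hpre⟩ := Prod.mk.inj heq
  have hlen : n₀ z = n₀ z' := by simpa using congrArg List.length hpre
  obtain ⟨N, hN⟩ := Function.ne_iff.1 hne
  have hN0 : n₀ z ≤ N := by
    by_contra hlt
    apply hN
    rw [← getElem_prefixWord z (n₀ z) N (by simp; omega),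
      ← getElem_prefixWord z' (n₀ z') N (by simp; omega)]
    exact List.getElem_of_eq hpre _
  obtain ⟨K, hK⟩ := Nat.exists_eq_add_of_le hN0
  have hloop : ∀ y : ℕ → A, ∃ k, K < k ∧
      M.evalFrom (q y) (prefixWord (fun i => y (n₀ y + i)) k) = q y := by
    intro y
    obtain ⟨n, hn, hqn⟩ := hq y (n₀ y + K + 1)
    obtain ⟨k, rfl⟩ := Nat.exists_eq_add_of_le (show n₀ y ≤ n by omega)
    refine ⟨k, by omega, ?_⟩
    rw [prefixWord_add, DFA.eval, DFA.evalFrom_of_append] at hqn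
    have h0 : M.evalFrom M.start (prefixWord y (n₀ y)) = q y := hn₀ y
    rwa [h0] at hqn
  obtain ⟨k, hk, hr⟩ := hloop z
  obtain ⟨k', hk', hr'⟩ := hloop z'
  rw [← hqq] at hr'
  set r := prefixWord (fun i => z (n₀ z + i)) k
  set r' := prefixWord (fun i => z' (n₀ z' + i)) k'
  have hrl : r.length = k := length_prefixWord _ _
  have hrl' : r'.length = k' := length_prefixWord _ _
  -- Both loops extend past the position `K` where they differ, so the two orders of concatenation
  -- have equal length and still differ there.
  refine ⟨r ++ r', r' ++ r, by simp [add_comm], fun h => ?_, fun l => ?_⟩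
  · have h1 : (r ++ r')[K]'(by simp; omega) = z N := by
      rw [List.getElem_append_left (by omega), getElem_prefixWord, hK]
    have h2 : (r' ++ r)[K]'(by simp; omega) = z' N := by
      rw [List.getElem_append_left (by omega), getElem_prefixWord, hK, hlen]
    apply hN
    rw [← h1, ← h2]
    exact List.getElem_of_eq h _
  · apply hsuffix (prefixWord z (n₀ z))
    have hl : M.evalFrom (q z) (l.flatMap fun b => if b then r' ++ r else r ++ r') = q z := by
      induction l with
      | nil => rfl
      | cons b l ih =>
        rw [List.flatMap_cons, DFA.evalFrom_of_append]
        have : M.evalFrom (q z) (if b then r' ++ r else r ++ r') = q z := by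
          split_ifs
          · rw [DFA.evalFrom_of_append, hr', hr]
          · rw [DFA.evalFrom_of_append, hr, hr']
        rw [this, ih]
    have h0 : M.evalFrom M.start (prefixWord z (n₀ z)) = q z := hn₀ z
    have h1 := hS z hz (n₀ z)
    rw [DFA.mem_accepts, DFA.eval, h0] at h1
    rw [DFA.mem_accepts, DFA.eval, DFA.evalFrom_of_append, h0, hl]
    exact h1

/-- The infinite concatenation of the words `U` and `V` of length `m` chosen by `ε`. -/
def concatenation (m : ℕ) (U V : ℕ → A) (ε : ℕ → Bool) (t : ℕ) : A :=
  if ε (t / m) then V (t % m) else U (t % m)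

/-- Arbitrarily long prefixes of an infinite concatenation are finite ones, hence in the language;
closedness does the rest. -/
theorem HasFreePair.exists_concatenation [TopologicalSpace A] {S : Set (ℕ → A)}
    (hcl : IsClosed S) (hS : shift '' S = S) (h : HasFreePair (language S)) :
    ∃ (m : ℕ) (U V : ℕ → A), (∃ j < m, U j ≠ V j) ∧ ∀ ε, concatenation m U V ε ∈ S := by
  obtain ⟨u, v, hlen, hne, hmem⟩ := h
  have hj : ∃ j, ∃ hu : j < u.length, ∃ hv : j < v.length, u[j] ≠ v[j] := by
    by_contra hno
    push Not at hno
    exact hne (List.ext_getElem hlen hno)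
  obtain ⟨j, hju, hjv, hj⟩ := hj
  let a := u[j]
  refine ⟨u.length, fun i => u.getD i a, fun i => v.getD i a, ⟨j, hju, ?_⟩, fun ε => ?_⟩
  · simpa [List.getD_eq_getElem, hju, hjv] using hj
  · set z := concatenation u.length (fun i => u.getD i a) (fun i => v.getD i a) ε with hz
    have key : ∀ k, prefixWord z (u.length * k) =
        ((List.range k).map ε).flatMap fun b => if b then v else u := by
      intro k
      induction k with
      | zero => rfl
      | succ k ih =>
        rw [Nat.mul_succ, prefixWord_add, ih, List.range_succ, List.map_append, List.flatMap_append]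
        congr 1
        simp only [List.map_cons, List.map_nil, List.flatMap_cons, List.flatMap_nil,
          List.append_nil]
        refine List.ext_getElem (by split_ifs <;> simp [hlen]) fun i h1 h2 => ?_
        have hi : i < u.length := by simpa using h1
        rw [getElem_prefixWord, hz, concatenation, Nat.mul_add_div (by omega),
          Nat.div_eq_of_lt hi, add_zero, Nat.mul_add_mod, Nat.mod_eq_of_lt hi]
        by_cases h : ε k = true
        · simp [h, hlen ▸ hi]
        · simp [h, hi]
    refine mem_of_prefixWord_mem_language hcl hS fun n => ⟨u.length * n, ?_, ?_⟩
    · exact Nat.le_mul_of_pos_left n (by omega)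
    · rw [key]
      exact hmem _

/-- The elements of a sofic subshift are obtained by concatenating words of length `N` along the
paths of a finite graph. -/
theorem exists_graph {A : Type u} [Finite A] [TopologicalSpace A] {S : Set (ℕ → A)}
    (hcl : IsClosed S) (hS : shift '' S = S) (hsof : IsSofic S) {N : ℕ} (hN : 0 < N) :
    ∃ (G : Type u) (_ : Finite G) (R : G → G → Prop) (out : G → ℕ → A),
      (∀ h : ℕ → G, (∀ k, R (h k) (h (k + 1))) → (fun t => out (h (t / N)) (t % N)) ∈ S) ∧
      ∀ z ∈ S, ∃ h : ℕ → G, (∀ k, R (h k) (h (k + 1))) ∧ ∀ t, out (h (t / N)) (t % N) = z t := by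
  obtain ⟨Q, _, M, hM⟩ := hsof
  let out : Q × (Fin N → A) → ℕ → A := fun g i => g.2 ⟨i % N, Nat.mod_lt _ hN⟩
  -- Reachability supplies a word to put before the output of a path, and acceptance puts the
  -- extended prefixes in the language.
  let R : Q × (Fin N → A) → Q × (Fin N → A) → Prop := fun g g' =>
    (∃ p, M.eval p = g.1) ∧ g.1 ∈ M.accept ∧ M.evalFrom g.1 (prefixWord (out g) N) = g'.1
  refine ⟨Q × (Fin N → A), inferInstance, R, out, fun h hR => ?_, fun z hz => ?_⟩
  · obtain ⟨p, hp⟩ := (hR 0).1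
    set z : ℕ → A := fun t => out (h (t / N)) (t % N) with hz
    have key : ∀ k, M.evalFrom (h 0).1 (prefixWord z (N * k)) = (h k).1 := by
      intro k
      induction k with
      | zero => rfl
      | succ k ih =>
        rw [Nat.mul_succ, prefixWord_add, DFA.evalFrom_of_append, ih, ← (hR k).2.2]
        congr 1
        refine List.ext_getElem (by simp) fun i h1 h2 => ?_
        have hi : i < N := by simpa using h1
        rw [getElem_prefixWord, getElem_prefixWord, hz]
        simp only
        rw [Nat.mul_add_div hN, Nat.div_eq_of_lt hi, add_zero, Nat.mul_add_mod,
          Nat.mod_eq_of_lt hi]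
    refine mem_of_prefixWord_mem_language hcl hS fun n => ⟨N * n, Nat.le_mul_of_pos_left n hN, ?_⟩
    apply mem_language_of_append (x := p)
    have hp' : M.evalFrom M.start p = (h 0).1 := hp
    rw [← hM, DFA.mem_accepts, DFA.eval, DFA.evalFrom_of_append, hp', key]
    exact (hR n).2.1
  · have hout : ∀ k i, i < N → out (M.eval (prefixWord z (N * k)), fun i => z (N * k + i)) i =
        z (N * k + i) := by
      intro k i hi
      simp only [out, Nat.mod_eq_of_lt hi]
    refine ⟨fun k => (M.eval (prefixWord z (N * k)), fun i => z (N * k + i)),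
      fun k => ⟨⟨_, rfl⟩, ?_, ?_⟩, fun t => ?_⟩
    · rw [← DFA.mem_accepts, hM]
      exact prefixWord_mem_language hz _
    · simp only
      rw [Nat.mul_succ, prefixWord_add, DFA.eval, DFA.evalFrom_of_append]
      congr 1
      refine List.ext_getElem (by simp) fun i h1 h2 => ?_
      have hi : i < N := by simpa using h1
      rw [getElem_prefixWord, getElem_prefixWord]
      exact hout k i hi
    · rw [hout _ _ (Nat.mod_lt _ hN), Nat.div_add_mod]

end Languages

end TraceCA

namespace TraceCA

universe u

/-! ### Coding graph paths by tracks in S -/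

section Coding

variable {A G : Type*} {m : ℕ} {U V : ℕ → A}

open Classical in
/-- The choices of words in the tracks that code the sequence `h`: the track `none` is constant,
the track `some none` alternates, and the track `some (some g)` tells where `h` equals `g`. -/
noncomputable def codeBits (h : ℕ → G) (κ : Option (Option G)) (j : ℕ) : Bool :=
  match κ with
  | none => false
  | some none => decide (j % 2 = 1)
  | some (some g) => decide (h (j / 2) = g)

/-- The coding of the sequence `h` by words `U` and `V` of length `m`, two in each track for each
element of the sequence. -/
noncomputable def code (m : ℕ) (U V : ℕ → A) (h : ℕ → G) (t : ℕ) (κ : Option (Option G)) : A :=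
  concatenation m U V (codeBits h κ) t

theorem code_congr (hm : 0 < m) {h h' : ℕ → G} {k k' i : ℕ} (hk : h k = h' k') (hi : i < 2 * m) :
    code m U V h (2 * m * k + i) = code m U V h' (2 * m * k' + i) := by
  have h1 : ∀ k, (2 * m * k + i) / m = 2 * k + i / m := fun k => by
    rw [show 2 * m * k + i = m * (2 * k) + i by ring, Nat.mul_add_div hm]
  have h2 : ∀ k, (2 * m * k + i) % m = i % m := fun k => by
    rw [show 2 * m * k + i = m * (2 * k) + i by ring, Nat.mul_add_mod]
  have h3 : i / m < 2 := Nat.div_lt_of_lt_mul (by linarith)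
  have h4 : ∀ k, (2 * k + i / m) / 2 = k := fun k => by
    generalize i / m = c at h3
    omega
  have h5 : ∀ k, (2 * k + i / m) % 2 = i / m := fun k => by
    generalize i / m = c at h3
    omega
  funext κ
  rcases κ with _ | _ | g
  · simp [code, concatenation, codeBits, h2]
  · simp [code, concatenation, codeBits, h1, h2, h5]
  · have : codeBits h (some (some g)) ((2 * m * k + i) / m) =
        codeBits h' (some (some g)) ((2 * m * k' + i) / m) := by
      simp only [codeBits]
      rw [decide_eq_decide, h1, h1, h4, h4, hk]
    simp only [code, concatenation, h2, this]

theorem code_shift (hm : 0 < m) (h : ℕ → G) (k t : ℕ) :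
    code m U V h (2 * m * k + t) = code m U V (fun l => h (k + l)) t := by
  have hlt := Nat.mod_lt t (show 0 < 2 * m by omega)
  have e : t = 2 * m * (t / (2 * m)) + t % (2 * m) := (Nat.div_add_mod _ _).symm
  rw [e, ← add_assoc, ← Nat.mul_add]
  exact code_congr hm rfl hlt

/-- At position `j` of a block, the track of `g` shows `V j` exactly when the vertex is `g`. -/
theorem eq_of_code_eq {j : ℕ} (hj : j < m) (hne : U j ≠ V j) {h h' : ℕ → G} {k k' : ℕ}
    (heq : code m U V h (2 * m * k + j) = code m U V h' (2 * m * k' + j)) : h k = h' k' := by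
  have h1 : ∀ k, (2 * m * k + j) / m = 2 * k := fun k => by
    rw [show 2 * m * k + j = m * (2 * k) + j by ring, Nat.mul_add_div (by omega),
      Nat.div_eq_of_lt hj, add_zero]
  have h2 : ∀ k, (2 * m * k + j) % m = j := fun k => by
    rw [show 2 * m * k + j = m * (2 * k) + j by ring, Nat.mul_add_mod, Nat.mod_eq_of_lt hj]
  have := congrFun heq (some (some (h k)))
  by_contra hcon
  simp [code, concatenation, codeBits, h1, h2, Ne.symm hcon] at this
  exact hne this.symm

/-- The first two tracks of a code. -/
theorem code_none (h : ℕ → G) (t : ℕ) : code m U V h t none = U (t % m) := rfl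

theorem code_some_none (h : ℕ → G) (t : ℕ) :
    code m U V h t (some none) = if t / m % 2 = 1 then V (t % m) else U (t % m) := by
  simp [code, concatenation, codeBits]

theorem code_clock_add (hm : 0 < m) (h h' : ℕ → G) (t k : ℕ) :
    code m U V h (t + 2 * m * k) none = code m U V h' t none ∧
      code m U V h (t + 2 * m * k) (some none) = code m U V h' t (some none) := by
  have h1 : (t + 2 * m * k) / m = t / m + 2 * k := by
    rw [show t + 2 * m * k = t + m * (2 * k) by ring, Nat.add_mul_div_left _ _ hm]
  have h2 : (t + 2 * m * k) % m = t % m := by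
    rw [show t + 2 * m * k = t + m * (2 * k) by ring, Nat.add_mul_mod_self_left]
  rw [code_none, code_none, code_some_none, code_some_none, h1, h2, Nat.add_mul_mod_self_left]
  exact ⟨rfl, rfl⟩

/-- Replacing `e` by `2 * m - e`, one may take `e ≤ m`. Some multiple of `e` then leads from a
position `t` in the first half, where both clocks show `U t`, to `m + j`, where they show `U j` and
`V j`. -/
theorem not_clock_period {j : ℕ} (hj : j < m) (hne : U j ≠ V j) (h : ℕ → G) {e : ℕ}
    (he0 : 0 < e) (he : e < 2 * m)
    (hper : ∀ t, code m U V h (t + e) none = code m U V h t none ∧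
      code m U V h (t + e) (some none) = code m U V h t (some none)) : False := by
  have hm : 0 < m := by omega
  wlog hem : e ≤ m generalizing e
  · refine this (e := 2 * m - e) (by omega) (by omega) (fun t => ?_) (by omega)
    have h1 := hper (t + (2 * m - e))
    have h2 := code_clock_add (U := U) (V := V) hm h h t 1
    rw [show t + (2 * m - e) + e = t + 2 * m * 1 by omega] at h1
    exact ⟨h1.1.symm.trans h2.1, h1.2.symm.trans h2.2⟩
  have hk : ∀ k t, code m U V h (t + e * k) none = code m U V h t none ∧
      code m U V h (t + e * k) (some none) = code m U V h t (some none) := by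
    intro k
    induction k with
    | zero => intro t; exact ⟨rfl, rfl⟩
    | succ k ih =>
      intro t
      rw [Nat.mul_succ, ← add_assoc]
      exact ⟨(hper _).1.trans (ih t).1, (hper _).2.trans (ih t).2⟩
  have h1 := Nat.div_add_mod j e
  have h2 := Nat.mod_lt j he0
  have h3 : e * (j / e + 1) = e * (j / e) + e := by ring
  obtain ⟨t, ht⟩ := Nat.exists_eq_add_of_le (show e * (j / e + 1) ≤ m + j by omega)
  have htm : t < m := by omega
  have h4 := hk (j / e + 1) t
  rw [show t + e * (j / e + 1) = m + j by omega, code_none, code_none, code_some_none,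
    code_some_none, Nat.add_mod_left, Nat.mod_eq_of_lt hj, Nat.mod_eq_of_lt htm,
    Nat.add_div_left _ hm, Nat.div_eq_of_lt hj, Nat.div_eq_of_lt htm] at h4
  simp at h4
  exact hne (h4.1.trans h4.2.symm)

/-- The clock tracks determine the phase. -/
theorem phase_unique {j : ℕ} (hj : j < m) (hne : U j ≠ V j) {h h' : ℕ → G} {s s' : ℕ}
    (heq : ∀ i < 2 * m, code m U V h (s + i) = code m U V h' (s' + i)) :
    s % (2 * m) = s' % (2 * m) := by
  have hm : 0 < m := by omega
  -- equality on a whole period gives equality everywhere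
  have hall : ∀ i, code m U V h (s % (2 * m) + i) none = code m U V h (s' % (2 * m) + i) none ∧
      code m U V h (s % (2 * m) + i) (some none) = code m U V h (s' % (2 * m) + i) (some none) := by
    intro i
    have hlt := Nat.mod_lt i (show 0 < 2 * m by omega)
    have red : ∀ (g : ℕ → G) s, code m U V h (s % (2 * m) + i) none =
        code m U V g (s + i % (2 * m)) none ∧ code m U V h (s % (2 * m) + i) (some none) =
        code m U V g (s + i % (2 * m)) (some none) := by
      intro g s
      have h1 := code_clock_add (U := U) (V := V) hm h g (s % (2 * m) + i % (2 * m)) (i / (2 * m))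
      have h2 := code_clock_add (U := U) (V := V) hm g g (s % (2 * m) + i % (2 * m)) (s / (2 * m))
      rw [add_assoc, Nat.mod_add_div] at h1
      rw [add_right_comm, Nat.mod_add_div] at h2
      exact ⟨h1.1.trans h2.1.symm, h1.2.trans h2.2.symm⟩
    have h1 := red h s
    have h2 := red h' s'
    rw [h1.1, h1.2, h2.1, h2.2, heq _ hlt]
    exact ⟨rfl, rfl⟩
  have hlt := Nat.mod_lt s (show 0 < 2 * m by omega)
  have hlt' := Nat.mod_lt s' (show 0 < 2 * m by omega)
  generalize s % (2 * m) = a at *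
  generalize s' % (2 * m) = b at *
  clear heq
  have main : ∀ (h h' : ℕ → G) a b, b < 2 * m → a < b →
      (∀ i, code m U V h (a + i) none = code m U V h' (b + i) none ∧
        code m U V h (a + i) (some none) = code m U V h' (b + i) (some none)) → False := by
    intro h h' a b hb hab hall
    refine not_clock_period hj hne h (e := b - a) (by omega) (by omega) fun t => ?_
    have h0 := code_clock_add (U := U) (V := V) hm h h
    have h0' := code_clock_add (U := U) (V := V) hm h' h
    have h1 := hall (t + (2 * m * a - a))
    have haa : a ≤ 2 * m * a := Nat.le_mul_of_pos_left a (by omega)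
    rw [show a + (t + (2 * m * a - a)) = t + 2 * m * a by omega,
      show b + (t + (2 * m * a - a)) = t + (b - a) + 2 * m * a by omega, (h0 _ a).1, (h0 _ a).2,
      (h0' _ a).1, (h0' _ a).2] at h1
    exact ⟨h1.1.symm, h1.2.symm⟩
  rcases lt_trichotomy a b with hab | hab | hab
  · exact (main h h' a b hlt' hab hall).elim
  · exact hab
  · exact (main h' h b a hlt hab fun i => ⟨(hall i).1.symm, (hall i).2.symm⟩).elim

end Coding

/-! ### Codes form a subshift of finite type that maps onto S -/

section CodeShift

variable {A G : Type*} {m : ℕ} {U V : ℕ → A} {R : G → G → Prop}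

/-- The factors of length `n` of the codes of paths of the graph `R`. -/
def codeWords (m : ℕ) (U V : ℕ → A) (R : G → G → Prop) (n : ℕ) :
    Set (Fin n → Option (Option G) → A) :=
  {y | ∃ (h : ℕ → G) (s : ℕ), (∀ k, R (h k) (h (k + 1))) ∧ s < 2 * m ∧
    ∀ i, y i = code m U V h (s + i)}

theorem code_mem_wordShift (hm : 0 < m) {h : ℕ → G} (hR : ∀ k, R (h k) (h (k + 1))) (n s : ℕ) :
    (fun t => code m U V h (s + t)) ∈ wordShift (codeWords m U V R n) := by
  intro t
  refine ⟨fun l => h ((s + t) / (2 * m) + l), (s + t) % (2 * m), fun k => hR _,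
    Nat.mod_lt _ (by omega), fun i => ?_⟩
  rw [← code_shift hm, ← add_assoc, Nat.div_add_mod, window, ← add_assoc]

/-- The shift of finite type defined by the factors of codes contains codes only. -/
theorem exists_code_of_mem_wordShift {j : ℕ} (hj : j < m) (hne : U j ≠ V j) {n : ℕ}
    (hn : 4 * m ≤ n) {η : ℕ → Option (Option G) → A}
    (hη : η ∈ wordShift (codeWords m U V R n)) :
    ∃ (h : ℕ → G) (s : ℕ), (∀ k, R (h k) (h (k + 1))) ∧ s < 2 * m ∧
      ∀ t, η t = code m U V h (s + t) := by
  have hm : 0 < m := by omega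
  choose H σ hR hσ hwin using hη
  have hwin' : ∀ t i, i < n → η (t + i) = code m U V (H t) (σ t + i) := fun t i hi =>
    hwin t ⟨i, hi⟩
  -- Overlapping windows agree on a whole clock period, so their phases advance together.
  have hphase : ∀ t, σ t = (σ 0 + t) % (2 * m) := by
    intro t
    induction t with
    | zero => rw [add_zero, Nat.mod_eq_of_lt (hσ 0)]
    | succ t ih =>
      have h1 := phase_unique (U := U) (V := V) (h := H (t + 1)) (h' := H t) (s := σ (t + 1))
        (s' := σ t + 1) hj hne fun i hi => by
          rw [← hwin' _ _ (by omega), add_assoc, add_assoc, ← hwin' _ _ (by omega)]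
      rw [Nat.mod_eq_of_lt (hσ _), ih, Nat.mod_add_mod] at h1
      rw [h1, add_assoc]
  -- the position where the block of index `k` starts
  let T : ℕ → ℕ := fun k => 2 * m * k - σ 0
  -- Truncated subtraction: the first block, possibly cut, is read from position 0.
  have hT0 : T 0 = 0 := by simp [T]
  have hTs : ∀ k, T (k + 1) + σ 0 = 2 * m * k + 2 * m := by
    intro k
    have := hσ 0
    simp only [T, Nat.mul_succ]
    omega
  have hσT : ∀ k, σ (T (k + 1)) = 0 := by
    intro k
    rw [hphase, add_comm, hTs, ← Nat.mul_succ, Nat.mul_mod_right]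
  -- The window at `t` reaches position `j` of the next block, so it identifies the next vertex.
  have hstep : ∀ t, H (t + (2 * m - σ t)) 0 = H t 1 ∨ σ (t + (2 * m - σ t)) ≠ 0 := by
    intro t
    by_cases h0 : σ (t + (2 * m - σ t)) = 0
    · left
      apply eq_of_code_eq hj hne
      have hs := hσ t
      rw [← (by rw [h0]; ring : σ (t + (2 * m - σ t)) + j = 2 * m * 0 + j), ← hwin' _ _ (by omega),
        add_assoc, hwin' _ _ (by omega)]
      congr 1
      omega
    · exact Or.inr h0
  have hTT : ∀ k, T k + (2 * m - σ (T k)) = T (k + 1) := by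
    intro k
    have h1 := hTs k
    have := hσ 0
    rcases k with _ | k
    · rw [hT0]
      omega
    · have h2 := hTs k
      rw [hσT, Nat.mul_succ] at *
      omega
  refine ⟨fun k => H (T k) 0, σ 0, fun k => ?_, hσ 0, fun t => ?_⟩
  · have h1 := hstep (T k)
    rw [hTT, hσT] at h1
    have h2 := hR (T k) 0
    simp only at h1 ⊢
    rw [h1.resolve_right (by simp)]
    exact h2
  · set τ := σ 0 + t with hτ
    have hi := Nat.mod_lt τ (show 0 < 2 * m by omega)
    have hdiv := Nat.div_add_mod τ (2 * m)
    generalize τ / (2 * m) = k at hdiv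
    generalize τ % (2 * m) = i at hdiv hi
    rw [← hdiv, code_congr (k := k) (h' := H (T k)) (k' := 0) hm rfl hi]
    have hs := hσ 0
    rcases k with _ | k
    · have h1 := hwin' 0 t (by omega)
      rw [zero_add] at h1
      rw [h1, hT0]
      congr 1
      omega
    · have h1 := hwin' (T (k + 1)) i (by omega)
      have h2 := hTs k
      rw [hσT] at h1
      rw [show 2 * m * 0 + i = 0 + i by ring, ← h1]
      congr 1
      rw [Nat.mul_succ] at hdiv
      omega

/-- The content of a frame for a sofic subshift with a free pair. -/
theorem exists_update_of_sofic {A : Type u} [Finite A] [TopologicalSpace A] {S : Set (ℕ → A)}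
    (hcl : IsClosed S) (hS : shift '' S = S) (hne : S.Nonempty) (hsof : IsSofic S)
    (hfree : HasFreePair (language S)) :
    ∃ (m : ℕ) (U : (Fin m → A) → Option (Fin m → A) → Fin m → A),
      (∀ (V : ℕ → Fin m → A) (I : ℕ → Option (Fin m → A)),
        (∀ t, V (t + 1) = U (V t) (I t)) → ∀ k, (fun t => V (t + 1) k) ∈ S) ∧
      ∀ z ∈ S, ∃ (v : ℤ → Fin m → A) (k : Fin m), ∀ V : ℕ → ℤ → Fin m → A, V 0 = v →
        (∀ t i, V (t + 1) i = U (V t i) (some (V t (i + 1)))) → ∀ t, V (t + 1) 0 k = z t := by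
  classical
  obtain ⟨m, U, V, ⟨j, hj, hUV⟩, hconc⟩ := hfree.exists_concatenation hcl hS
  have hm : 0 < m := by omega
  obtain ⟨G, _, R, out, hout, hS'⟩ := exists_graph hcl hS hsof (show 0 < 2 * m by omega)
  obtain ⟨z₀, hz₀⟩ := hne
  -- The next vertex is read, not the current one, whose distinguishing positions may already have
  -- passed.
  let π : (Fin (4 * m + 1) → Option (Option G) → A) → A := fun y =>
    if hy : y ∈ codeWords m U V R (4 * m + 1) then out (hy.choose 1) hy.choose_spec.choose else z₀ 0
  have hπ : ∀ h : ℕ → G, (∀ k, R (h k) (h (k + 1))) → ∀ s, 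
      π (window (4 * m + 1) (fun t => code m U V h t) s) =
        out (h (s / (2 * m) + 1)) (s % (2 * m)) := by
    intro h hR s
    have hy : window (4 * m + 1) (fun t => code m U V h t) s ∈ codeWords m U V R (4 * m + 1) := by
      have := code_mem_wordShift (U := U) (V := V) hm hR (4 * m + 1) 0 s
      simpa only [zero_add] using this
    simp only [π]
    rw [dif_pos hy]
    have hspec := hy.choose_spec.choose_spec
    generalize hy.choose_spec.choose = s' at hspec ⊢
    generalize hy.choose = h' at hspec ⊢
    obtain ⟨-, hs', heq⟩ := hspec
    have heq' : ∀ i < 4 * m + 1, code m U V h (s + i) = code m U V h' (s' + i) := fun i hi =>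
      heq ⟨i, hi⟩
    have hphase := phase_unique hj hUV fun i hi => heq' i (by omega)
    rw [Nat.mod_eq_of_lt hs'] at hphase
    rw [hphase]
    congr 1
    apply Eq.symm
    apply eq_of_code_eq hj hUV
    have h1 := heq' (2 * m - s' + j) (by omega)
    have h2 := Nat.div_add_mod s (2 * m)
    rw [show s + (2 * m - s' + j) = 2 * m * (s / (2 * m) + 1) + j by rw [Nat.mul_succ]; omega,
      show s' + (2 * m - s' + j) = 2 * m * 1 + j by omega] at h1
    exact h1
  refine exists_update ⟨z₀, hz₀⟩ (codeWords m U V R (4 * m + 2)) π ?_ ?_ ?_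
  · intro η hη κ
    obtain ⟨h, s, hR, hs, h1⟩ := exists_code_of_mem_wordShift hj hUV (by omega) hη
    convert tail_mem hS (hconc (codeBits h κ)) s using 1
    funext t
    rw [h1, add_comm]
    rfl
  · intro η hη
    obtain ⟨h, s, hR, hs, h1⟩ := exists_code_of_mem_wordShift hj hUV (by omega) hη
    convert tail_mem hS (hout (fun k => h (k + 1)) fun k => hR _) s using 1
    funext t
    rw [add_comm t s, ← hπ h hR]
    congr 1
    funext i
    rw [window, window, h1, add_assoc]
  · intro z hz
    -- Compensates for `π` reading one block ahead.
    obtain ⟨z', hz', hzz⟩ := exists_tail_eq hS hz (2 * m)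
    obtain ⟨h, hR, hh⟩ := hS' z' hz'
    refine ⟨fun t => code m U V h t, ?_, fun t => ?_⟩
    · have := code_mem_wordShift (U := U) (V := V) hm hR (4 * m + 2) 0
      simpa only [zero_add] using this
    · rw [hπ h hR, ← hzz, ← hh, Nat.add_div_right _ (by omega), Nat.add_mod_right]

end CodeShift

end TraceCA

namespace TraceCA

universe u

/-! ### Subshifts of finite type and their periodic points -/

section FiniteType

variable {A : Type*}

/-- The factors of length `n` of the elements of `S`. -/
def factorWords (S : Set (ℕ → A)) (n : ℕ) : Set (Fin n → A) := {y | ∃ s ∈ S, window n s 0 = y}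

theorem subset_wordShift_factorWords {S : Set (ℕ → A)} (hS : shift '' S = S) (n : ℕ) :
    S ⊆ wordShift (factorWords S n) := by
  intro z hz t
  refine ⟨_, tail_mem hS hz t, ?_⟩
  funext i
  simp only [window]
  congr 1
  omega

theorem exists_length_le {W : Set (List A)} (hW : W.Finite) : ∃ N, ∀ w ∈ W, w.length ≤ N := by
  obtain ⟨N, hN⟩ := (hW.image List.length).bddAbove
  exact ⟨N, fun w hw => hN (Set.mem_image_of_mem _ hw)⟩

theorem IsFiniteType.exists_wordShift_subset {S : Set (ℕ → A)} (h : IsFiniteType S) :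
    ∃ n, wordShift (factorWords S (n + 2)) ⊆ S := by
  obtain ⟨W, hW, rfl⟩ := h
  obtain ⟨N, hN⟩ := exists_length_le hW
  refine ⟨N, fun y hy w hw hfac => ?_⟩
  obtain ⟨i, hi⟩ := hfac
  obtain ⟨s, hs, hsy⟩ := hy i
  refine hs w hw ⟨0, fun k => ?_⟩
  rw [← hi k]
  have := congrFun hsy ⟨k, by have := hN w hw; omega⟩
  simpa [window] using this

/-- The content of a frame for a subshift of finite type. -/
theorem exists_update_of_local {S : Set (ℕ → A)} (hS : shift '' S = S) (hne : S.Nonempty) {n : ℕ}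
    (hloc : wordShift (factorWords S (n + 2)) ⊆ S) :
    ∃ (m : ℕ) (U : (Fin m → A) → Option (Fin m → A) → Fin m → A),
      (∀ (V : ℕ → Fin m → A) (I : ℕ → Option (Fin m → A)),
        (∀ t, V (t + 1) = U (V t) (I t)) → ∀ k, (fun t => V (t + 1) k) ∈ S) ∧
      ∀ z ∈ S, ∃ (v : ℤ → Fin m → A) (k : Fin m), ∀ V : ℕ → ℤ → Fin m → A, V 0 = v →
        (∀ t i, V (t + 1) i = U (V t i) (some (V t (i + 1)))) → ∀ t, V (t + 1) 0 k = z t := by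
  have hmem : ∀ η : ℕ → Unit → A,
      η ∈ wordShift {y : Fin (n + 2) → Unit → A | (fun i => y i ()) ∈ factorWords S (n + 2)} →
        (fun t => η t ()) ∈ S := fun η hη => hloc fun t => hη t
  refine exists_update hne (K := Unit)
    {y : Fin (n + 2) → Unit → A | (fun i => y i ()) ∈ factorWords S (n + 2)} (fun y => y 0 ())
    (fun η hη _ => hmem η hη) (fun η hη => hmem η hη) fun z hz => ?_
  exact ⟨fun t _ => z t, fun t => subset_wordShift_factorWords hS _ hz t, fun t => rfl⟩

theorem periodic_of_window_eq {n : ℕ} {z : ℕ → A} {i d : ℕ} (hd : 0 < d)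
    (h : window n z i = window n z (i + d)) (x : ℕ) (hx : x < n + d) :
    z (i + x) = z (i + x % d) := by
  induction x using Nat.strong_induction_on with
  | _ x ih =>
    rcases lt_or_ge x d with hlt | hge
    · rw [Nat.mod_eq_of_lt hlt]
    · have h1 := congrFun h ⟨x - d, by omega⟩
      simp only [window] at h1
      rw [show i + d + (x - d) = i + x by omega] at h1
      rw [← h1, ih (x - d) (by omega) (by omega), ← Nat.mod_eq_sub_mod hge]

/-- Repeating the word between two occurrences of a window creates no factor of length `n` absent
from `z`. -/
theorem periodic_mem_of_window_eq {S : Set (ℕ → A)} {n : ℕ} (hS : shift '' S = S)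
    (hloc : wordShift (factorWords S n) ⊆ S) {z : ℕ → A} (hz : z ∈ S) {i d : ℕ} (hd : 0 < d)
    (h : window n z i = window n z (i + d)) : (fun t => z (i + t % d)) ∈ S := by
  apply hloc
  intro t
  convert subset_wordShift_factorWords hS n hz (i + t % d) using 1
  funext r
  have hlt := Nat.mod_lt t hd
  simp only [window]
  rw [add_assoc, periodic_of_window_eq hd h (t % d + r) (by omega), Nat.mod_add_mod]

/-- A surjective subshift of finite type that is not a fixed point contains a periodic point other
than this fixed point. -/
theorem exists_periodic_of_local [Finite A] {S : Set (ℕ → A)} (hS : shift '' S = S) {n : ℕ}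
    (hloc : wordShift (factorWords S n) ⊆ S) {a : A} (hne : ∃ z ∈ S, ∃ j, z j ≠ a) :
    ∃ w ∈ S, ∃ d, 0 < d ∧ (∀ t, w (t + d) = w t) ∧ ∃ j, w j ≠ a := by
  by_contra hno
  push Not at hno
  -- a repeated window surrounds letters `a` only
  have key : ∀ z ∈ S, ∀ i d, 0 < d → window n z i = window n z (i + d) →
      ∀ x < n + d, z (i + x) = a := by
    intro z hz i d hd h x hx
    rw [periodic_of_window_eq hd h x hx]
    have := hno _ (periodic_mem_of_window_eq hS hloc hz hd h) d hd
      (fun t => by simp) x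
    exact this
  have hpigeon : ∀ z : ℕ → A, ∀ s, ∃ i d, 0 < d ∧ s ≤ i ∧ i + d ≤ s + Nat.card (Fin n → A) ∧
      window n z i = window n z (i + d) := by
    intro z s
    have := Fintype.ofFinite (Fin n → A)
    obtain ⟨x, y, hxy, heq⟩ := Fintype.exists_ne_map_eq_of_card_lt
      (fun x : Fin (Nat.card (Fin n → A) + 1) => window n z (s + x))
      (by simp [Nat.card_eq_fintype_card])
    have hx := x.isLt
    have hy := y.isLt
    have hxy' : (x : ℕ) ≠ y := fun h => hxy (Fin.ext h)
    rcases lt_or_gt_of_ne hxy' with h | h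
    · refine ⟨s + x, y - x, by omega, by omega, by omega, ?_⟩
      rw [show s + (x : ℕ) + (y - x) = s + y by omega]
      exact heq
    · refine ⟨s + y, x - y, by omega, by omega, by omega, ?_⟩
      rw [show s + (y : ℕ) + (x - y) = s + x by omega]
      exact heq.symm
  -- Surjectivity gives room on the left for a repeated window on each side of the letter other than
  -- `a`. Both windows consist of letters `a`, so together they form a repetition, which forces `a`
  -- in between.
  obtain ⟨z₀, hz₀, j, hj⟩ := hne
  obtain ⟨z, hz, hzz⟩ := exists_tail_eq hS hz₀ (Nat.card (Fin n → A))
  obtain ⟨i, d, hd, -, hi, h1⟩ := hpigeon z 0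
  obtain ⟨i', d', hd', hi', -, h2⟩ := hpigeon z (Nat.card (Fin n → A) + j + 1)
  have h3 := key z hz i d hd h1
  have h4 := key z hz i' d' hd' h2
  apply hj
  rw [← hzz]
  have h5 := key z hz i (i' - i) (by omega) (by
    funext r
    rw [show i + (i' - i) = i' by omega]
    simp only [window]
    rw [h3 r (by omega), h4 r (by omega)]) (j + Nat.card (Fin n → A) - i) (by omega)
  rwa [show i + (j + Nat.card (Fin n → A) - i) = j + Nat.card (Fin n → A) by omega] at h5

end FiniteType

/-! ### The one-sided realization -/

section OneSided

/-- The onesided realization. -/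
theorem exists_trace_eq {A : Type u} [Finite A] [TopologicalSpace A] {S : Set (ℕ → A)}
    (hcl : IsClosed S) (hS : shift '' S = S) {ξ : A → A} {b : A} {p : ℕ} (hp : 0 < p)
    (hb : ξ^[p] b = b) (hbS : (fun t => ξ^[t] b) ∈ S)
    (h : (∃ n, wordShift (factorWords S (n + 2)) ⊆ S) ∨
      (IsSofic S ∧ HasFreePair (language S))) :
    ∃ (F : CellularAutomaton A) (J : ℕ), shift^[J] '' F.trace = S := by
  have hne : S.Nonempty := ⟨_, hbS⟩
  obtain ⟨m, U, hU, hUS⟩ : ∃ (m : ℕ) (U : (Fin m → A) → Option (Fin m → A) → Fin m → A),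
      (∀ (V : ℕ → Fin m → A) (I : ℕ → Option (Fin m → A)),
        (∀ t, V (t + 1) = U (V t) (I t)) → ∀ k, (fun t => V (t + 1) k) ∈ S) ∧
      ∀ z ∈ S, ∃ (v : ℤ → Fin m → A) (k : Fin m), ∀ V : ℕ → ℤ → Fin m → A, V 0 = v →
        (∀ t i, V (t + 1) i = U (V t i) (some (V t (i + 1)))) → ∀ t, V (t + 1) 0 k = z t := by
    rcases h with ⟨n, hloc⟩ | ⟨hsof, hfree⟩
    · exact exists_update_of_local hS hne hloc
    · exact exists_update_of_sofic hcl hS hne hsof hfree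
  by_cases hξ : ξ b = b
  · have hit : ∀ t, ξ^[t] b = b := fun t => Function.IsFixedPt.iterate hξ t
    simp only [hit] at hbS
    by_cases hconst : ∃ z ∈ S, ∃ j, z j ≠ b
    · obtain ⟨w, hw, d, hd, hwd, j, hj⟩ :
          ∃ w ∈ S, ∃ d, 0 < d ∧ (∀ t, w (t + d) = w t) ∧ ∃ j, w j ≠ b := by
        rcases h with ⟨n, hloc⟩ | ⟨-, hfree⟩
        · exact exists_periodic_of_local hS hloc hconst
        · obtain ⟨m, U, V, ⟨j, hj, hne⟩, hconc⟩ := hfree.exists_concatenation hcl hS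
          by_cases hUj : U j = b
          · refine ⟨_, hconc fun _ => true, m, by omega, fun t => by simp [concatenation], j, ?_⟩
            simpa [concatenation, Nat.mod_eq_of_lt hj] using fun h => hne (hUj.trans h.symm)
          · refine ⟨_, hconc fun _ => false, m, by omega, fun t => by simp [concatenation], j, ?_⟩
            simpa [concatenation, Nat.mod_eq_of_lt hj] using hUj
      have hper : ∀ k t, w (t + d * k) = w t := by
        intro k
        induction k with
        | zero => intro t; rfl
        | succ k ih => intro t; rw [Nat.mul_succ, ← add_assoc, hwd, ih]
      -- Two periods guarantee two letters other than `b` in every factor of length `T`.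
      obtain ⟨F, hF⟩ := exists_of_fixed (T := 2 * d) hS hbS hw
        (fun t => by rw [mul_comm]; exact hper 2 t) (fun t => by
          have hk := Nat.mod_lt (j + (d * t - t)) hd
          have hle : t ≤ d * t := Nat.le_mul_of_pos_left t hd
          have h1 : w (t + (j + (d * t - t)) % d) ≠ b := by
            have h2 := Nat.mod_add_div (j + (d * t - t)) d
            rw [← hper ((j + (d * t - t)) / d), add_assoc, h2,
              show t + (j + (d * t - t)) = j + d * t by omega, hper]
            exact hj
          refine ⟨_, (j + (d * t - t)) % d + d, by omega, by omega, h1, ?_⟩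
          rw [← add_assoc, hwd]
          exact h1) U hU hUS
      exact ⟨F, 2, hF⟩
    · push Not at hconst
      obtain ⟨F, hF⟩ := exists_cellularAutomaton (fun (_ : ℤ → A) (_ : ℤ) => b) 0
        fun _ _ _ _ _ => rfl
      refine ⟨F, 1, Set.Subset.antisymm ?_ ?_⟩
      · rintro _ ⟨_, ⟨x, rfl⟩, rfl⟩
        convert hbS using 1
        funext t
        rw [shift_iterate_apply]
        simp only [Function.iterate_succ_apply', hF]
      · intro z hz
        refine ⟨_, ⟨fun _ => b, rfl⟩, ?_⟩
        funext t
        rw [shift_iterate_apply]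
        simp only [Function.iterate_succ_apply', hF, hconst z hz]
  · obtain ⟨F, hF⟩ := exists_of_cycle hS hp hb hbS hξ U hU hUS
    exact ⟨F, 2, hF⟩

theorem exists_periodic_point {A : Type*} [Finite A] {A' : Set A} {ξ : A → A} (hA' : A'.Nonempty)
    (hξ : Set.MapsTo ξ A' A') : ∃ b p, 0 < p ∧ ξ^[p] b = b ∧ ∀ t, ξ^[t] b ∈ A' := by
  obtain ⟨a, ha⟩ := hA'
  have hmem : ∀ t, ξ^[t] a ∈ A' := fun t => hξ.iterate t ha
  obtain ⟨i, j, hij, heq⟩ := Finite.exists_ne_map_eq_of_infinite fun t : ℕ => ξ^[t] a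
  wlog hlt : i < j generalizing i j
  · exact this j i hij.symm heq.symm (by omega)
  refine ⟨ξ^[i] a, j - i, by omega, ?_, fun t => ?_⟩
  · rw [← Function.iterate_add_apply, Nat.sub_add_cancel hlt.le]
    exact heq.symm
  · rw [← Function.iterate_add_apply]
    exact hmem _

end OneSided

/-! ### Passage to two-sided subshifts -/

section TwoSided

variable {A : Type*}

/-- The right rays of the elements of `S`. -/
def rightRays (S : Set (ℤ → A)) : Set (ℕ → A) := (fun z (i : ℕ) => z i) '' S

/-- The reversed left rays of the elements of `S`. -/
def leftRays (S : Set (ℤ → A)) : Set (ℕ → A) := (fun z (i : ℕ) => z (-i)) '' S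

theorem translate_mem {S : Set (ℤ → A)} (hS : shift '' S = S) {z : ℤ → A} (hz : z ∈ S) (j : ℤ) :
    (fun i => z (i + j)) ∈ S := by
  induction j using Int.induction_on with
  | zero => simpa using hz
  | succ j ih =>
    have := Set.mem_image_of_mem shift ih
    rw [hS] at this
    convert this using 1
    funext i
    simp only [shift]
    congr 1
    ring
  | pred j ih =>
    rw [← hS] at ih
    obtain ⟨y, hy, h⟩ := ih
    convert hy using 1
    funext i
    have := congrFun h (i - 1)
    simp only [shift, sub_add_cancel] at this
    rw [this]
    congr 1
    ring

theorem shift_image_rightRays {S : Set (ℤ → A)} (hS : shift '' S = S) :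
    shift '' rightRays S = rightRays S := by
  rw [rightRays, ← Set.image_comp]
  conv_rhs => rw [← hS, ← Set.image_comp]
  rfl

theorem language_rightRays {S : Set (ℤ → A)} (hS : shift '' S = S) :
    language (rightRays S) = language S := by
  ext w
  constructor
  · rintro ⟨_, ⟨z, hz, rfl⟩, i, hi⟩
    exact ⟨z, hz, i, fun k => by rw [← hi k]; push_cast; rfl⟩
  · rintro ⟨z, hz, i, hi⟩
    refine ⟨_, ⟨_, translate_mem hS hz i, rfl⟩, 0, fun k => ?_⟩
    rw [← hi k]
    simp only
    congr 1
    push_cast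
    ring

theorem isClosed_rightRays [TopologicalSpace A] [DiscreteTopology A] [Finite A] {S : Set (ℤ → A)}
    (hcl : IsClosed S) : IsClosed (rightRays S) :=
  (hcl.isCompact.image (continuous_pi fun _ => continuous_apply _)).isClosed

/-- A locally legal ray is extended to the left by the past of an element showing its first window.
Any forbidden word starting in the past is too short to leave that element's range. -/
theorem exists_wordShift_rightRays_subset {S : Set (ℤ → A)}
    (h : IsFiniteType S) : ∃ n, wordShift (factorWords (rightRays S) (n + 2)) ⊆ rightRays S := by
  obtain ⟨W, hW, hSW⟩ := h
  obtain ⟨N, hN⟩ := exists_length_le hW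
  refine ⟨N, fun y hy => ?_⟩
  obtain ⟨_, ⟨z, hz, rfl⟩, hzy⟩ := hy 0
  have hzy' : ∀ i : ℕ, i < N + 2 → z i = y i := by
    intro i hi
    have := congrFun hzy ⟨i, hi⟩
    simpa [window] using this
  let x : ℤ → A := fun i => if i < 0 then z i else y i.toNat
  have hx0 : ∀ i : ℤ, i < N + 2 → x i = z i := by
    intro i hi
    simp only [x]
    split_ifs with h0
    · rfl
    · rw [← hzy' _ (by omega), Int.toNat_of_nonneg (by omega)]
  have hxn : ∀ i : ℕ, x i = y i := by
    intro i
    simp only [x]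
    rw [if_neg (by omega), Int.toNat_natCast]
  refine ⟨x, ?_, funext hxn⟩
  rw [hSW]
  rintro w hw ⟨i, hi⟩
  have hwN := hN w hw
  rcases lt_or_ge i 0 with h0 | h0
  · rw [hSW] at hz
    refine hz w hw ⟨i, fun k => ?_⟩
    rw [← hi k, hx0 _ (by omega)]
  · obtain ⟨i, rfl⟩ := Int.eq_ofNat_of_zero_le h0
    obtain ⟨_, ⟨s, hs, rfl⟩, hsy⟩ := hy i
    rw [hSW] at hs
    refine hs w hw ⟨0, fun k => ?_⟩
    have := congrFun hsy ⟨k, by omega⟩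
    simp only [window, zero_add] at this
    rw [← hi k, zero_add, this, ← hxn]
    congr 1

theorem prefixWord_reverse_mem_language {S : Set (ℤ → A)} {z : ℕ → A} (hz : z ∈ leftRays S)
    (n : ℕ) : (prefixWord z n).reverse ∈ language S := by
  obtain ⟨x, hx, rfl⟩ := hz
  refine ⟨x, hx, -(n : ℤ) + 1, fun k => ?_⟩
  have hk := k.isLt
  simp only [List.length_reverse, length_prefixWord] at hk
  simp only [List.get_eq_getElem, List.getElem_reverse, getElem_prefixWord, length_prefixWord]
  congr 1
  omega

theorem mem_language_of_append_left {M : Type*} [AddMonoidWithOne M] {S : Set (M → A)}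
    {x y : List A} (h : x ++ y ∈ language S) : x ∈ language S := by
  obtain ⟨z, hz, i, hi⟩ := h
  refine ⟨z, hz, i, fun k => ?_⟩
  have := hi ⟨k, by have := k.isLt; simp; omega⟩
  simpa [List.getElem_append_left] using this

/-- The right rays alone may be countable; then the left rays are not, and the reversed language has
a free pair. -/
theorem hasFreePair_of_uncountable [Finite A] {S : Set (ℤ → A)} (hS : shift '' S = S)
    (hsof : IsSofic S) (hunc : ¬ S.Countable) : HasFreePair (language S) := by
  have hrays : ¬ (rightRays S).Countable ∨ ¬ (leftRays S).Countable := by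
    by_contra hno
    push Not at hno
    apply hunc
    refine Set.MapsTo.countable_of_injOn (t := rightRays S ×ˢ leftRays S)
      (f := fun z => (fun i : ℕ => z i, fun i : ℕ => z (-i))) ?_ ?_ (hno.1.prod hno.2)
    · exact fun z hz => ⟨⟨z, hz, rfl⟩, ⟨z, hz, rfl⟩⟩
    · intro z _ z' _ h
      obtain ⟨h1, h2⟩ := Prod.mk.inj h
      funext i
      rcases le_total 0 i with hi | hi
      · obtain ⟨i, rfl⟩ := Int.eq_ofNat_of_zero_le hi
        exact congrFun h1 i
      · obtain ⟨k, rfl⟩ := Int.exists_eq_neg_ofNat hi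
        exact congrFun h2 k
  rcases hrays with h | h
  · refine exists_freePair hsof (fun x y => mem_language_of_append) (fun z hz n => ?_) h
    rw [← language_rightRays hS]
    exact prefixWord_mem_language hz n
  · refine HasFreePair.of_reverse (exists_freePair (Language.IsRegular.reverse hsof)
      (fun x y hxy => ?_) (fun z hz n => ?_) h)
    · rw [Language.mem_reverse, List.reverse_append] at hxy
      exact mem_language_of_append_left hxy
    · exact prefixWord_reverse_mem_language hz n

/-- Every ray of a bi-infinite column has a past of length `J`, hence is a right ray of S, and S is
closed. Conversely, all rays of an element of S are in the trace, and compactness glues the orbits.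
-/
theorem bitrace_eq [TopologicalSpace A] [DiscreteTopology A] [Finite A] {S : Set (ℤ → A)}
    (hcl : IsClosed S) (hS : shift '' S = S) {F : CellularAutomaton A} {J : ℕ}
    (hF : shift^[J] '' F.trace = rightRays S) (hlim : F.limitTrace = rightRays S) :
    F.bitrace = S := by
  apply Set.Subset.antisymm
  · rintro z ⟨x, hx, hz⟩
    refine mem_of_central hcl fun n => ?_
    have horb : ∀ (j : ℤ) (t : ℕ), F.globalMap^[t] (x j) = x (j + t) := by
      intro j t
      induction t with
      | zero => simp
      | succ t ih =>
        rw [Function.iterate_succ_apply', ih, hx]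
        congr 1
        push_cast
        ring
    have hmem : (fun t : ℕ => z (-(n : ℤ) + t)) ∈ rightRays S := by
      rw [← hF]
      refine ⟨_, ⟨x (-(n : ℤ) - J), rfl⟩, ?_⟩
      funext t
      rw [shift_iterate_apply]
      simp only [horb, hz]
      congr 1
      push_cast
      ring
    obtain ⟨s, hs, hsz⟩ := hmem
    refine ⟨_, translate_mem hS hs n, fun i hi => ?_⟩
    rw [abs_lt] at hi
    have := congrFun hsz (i + n).toNat
    simp only [Int.toNat_of_nonneg (show 0 ≤ i + n by omega)] at this
    rw [this]
    congr 1
    ring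
  · intro z hz
    refine mem_bitrace_of_rays F fun n => ?_
    have hray : (fun j : ℕ => z (-(n : ℤ) + j)) ∈ F.limitTrace := by
      rw [hlim]
      refine ⟨_, translate_mem hS hz (-(n : ℤ)), ?_⟩
      funext i
      simp only
      congr 1
      ring
    have := Set.mem_iInter.1 hray 0
    simpa using this

end TwoSided

end TraceCA

theorem mainTheorem8 {A : Type*} [Finite A] [TopologicalSpace A] [DiscreteTopology A] :
    (∀ S : Set (ℕ → A), TraceCA.IsOneSidedSubshift S → TraceCA.IsSurjectiveSubshift S →
      TraceCA.ContainsDeterministic S →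
      (TraceCA.IsFiniteType S ∨ (TraceCA.IsSofic S ∧ ¬ S.Countable)) →
      ∃ F : TraceCA.CellularAutomaton A, F.IsStable ∧ F.limitTrace = S) ∧
    (∀ S : Set (ℤ → A), TraceCA.IsTwoSidedSubshift S →
      TraceCA.ContainsBiDeterministic S →
      (TraceCA.IsFiniteType S ∨ (TraceCA.IsSofic S ∧ ¬ S.Countable)) →
      ∃ F : TraceCA.CellularAutomaton A, F.IsStable ∧ F.bitrace = S) := by
  open TraceCA in
  refine ⟨fun S hsub hsurj hdet h => ?_, fun S hsub hdet h => ?_⟩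
  · obtain ⟨A', ξ, hA', hξ, hdet⟩ := hdet
    obtain ⟨b, p, hp, hb, hmem⟩ := exists_periodic_point hA' hξ
    obtain ⟨F, J, hF⟩ := exists_trace_eq hsub.1 hsurj hp hb (hdet ⟨b, hmem 0, fun _ => rfl⟩)
      (h.imp (fun h => h.exists_wordShift_subset) fun h => ⟨h.1, exists_freePair h.1
        (fun x y => mem_language_of_append) (fun z hz n => prefixWord_mem_language hz n) h.2⟩)
    exact ⟨F, limitTrace_eq F hsurj hF⟩
  · obtain ⟨A', ξ, hA', hξ, hdet⟩ := hdet
    obtain ⟨b, p, hp, hb, hmem⟩ := exists_periodic_point hA' hξ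
    have hS := hsub.2
    -- Periodicity of `b` extends its orbit to a bi-infinite one.
    have horb : (fun t => ξ^[t] b) ∈ rightRays S := by
      have hmod : ∀ t, ξ^[t % p] b = ξ^[t] b := fun t =>
        Function.IsPeriodicPt.iterate_mod_apply hb t
      refine ⟨fun i => ξ^[(i % p).toNat] b, hdet fun i => ⟨hmem _, ?_⟩, ?_⟩
      · have h0 := Int.emod_nonneg i (show (p : ℤ) ≠ 0 by omega)
        rw [← Function.iterate_succ_apply' ξ, ← hmod ((i % p).toNat + 1)]
        congr 2
        zify
        rw [Int.toNat_of_nonneg (Int.emod_nonneg _ (by omega)), Int.toNat_of_nonneg h0,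
          Int.emod_add_emod]
      · funext t
        simp only
        rw [← hmod t]
        congr 1
    obtain ⟨F, J, hF⟩ := exists_trace_eq (isClosed_rightRays hsub.1) (shift_image_rightRays hS) hp
      hb horb (h.imp (fun h => exists_wordShift_rightRays_subset h) fun h =>
        ⟨by rw [IsSofic, language_rightRays hS]; exact h.1,
          by rw [language_rightRays hS]; exact hasFreePair_of_uncountable hS h.1 h.2⟩)
    obtain ⟨h1, h2⟩ := limitTrace_eq F (shift_image_rightRays hS) hF
    exact ⟨F, h1, bitrace_eq hsub.1 hS hF h2⟩
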